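/- Let $k>0$ and let $f_0\in C^1(\mathbb{R})$ be real-valued with $f_0'\in W^{1,1}(\mathbb{R})$. Here $W^{1,1}(\mathbb{R})$ is the space of complex-valued $f\in L^1(\mathbb{R})$ whose weak derivative $f'$ lies in $L^1(\mathbb{R})$, with norm $\|f\|_{1,1}=\|f\|_1+\|f'\|_1$. In $W^{1,1}(\mathbb{R})$ consider the operator $$(Tf)(v)=i v f(v)-i k^{-2} f_0'(v)\int_{\mathbb{R}} f(w)\,dw,\qquad D(T)=\{f\in W^{1,1}(\mathbb{R}) : vf\in W^{1,1}(\mathbb{R})\}$$ (for $k=1$ this is $Tf=ivf-if_0'\int f$). Let $\sigma(T)$ be the set of $\lambda\in\mathbb{C}$ such that $T-\lambda I$ has no bounded inverse defined on all of $W^{1,1}(\mathbb{R})$. Let $\sigma_p(T)$ be the set of $\lambda$ for which $T-\lambda I$ is not injective; $\sigma_r(T)$ the set of $\lambda$ for which $T-\lambda I$ is injective but its inverse is not densely defined (its range is not dense); and $\sigma_c(T)$ the set of $\lambda$ for which $T-\lambda I$ is injective and its inverse is densely defined but unbounded. For $u\in\mathbb{C}$ say that $\varepsilon(k,u)=0$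 if $v\mapsto f_0'(v)/(v-u)$ is Lebesgue integrable on $\mathbb{R}$ and $$1-k^{-2}\int_{\mathbb{R}}\frac{f_0'(v)}{v-u}\,dv=0 .$$ Then $\sigma(T)=\sigma_p(T)\cup\sigma_c(T)\cup\sigma_r(T)$, and: 1. Every $\lambda\in\sigma_p(T)$ is of the form $\lambda=iu$ with $u\in\mathbb{C}$ and $\varepsilon(k,u)=0$. Conversely, if $\varepsilon(k,u)=0$, and either $u\notin\mathbb{R}$, or $u\in\mathbb{R}$ and $f_0$ is $C^2$ near $u$ with $f_0''$ H\"older continuous at $u$ (that is, $|f_0''(v)-f_0''(u)|\le C|v-u|^{\alpha}$ for $v$ near $u$, with some $\alpha>0$ and some $C$), then $iu\in\sigma_p(T)$. In particular, if $f_0\in C^3(\mathbb{R})$, then $\sigma_p(T)=\{iu : u\in\mathbb{C},\ \varepsilon(k,u)=0\}$. 2. $\sigma_c(T)=\{iu : u\in\mathbb{R},\ iu\notin\sigma_p(T),\ f_0'(u)\neq 0\}$. 3. $\sigma_r(T)=\{iu : u\in\mathbb{R},\ iu\notin\sigma_p(T),\ f_0'(u)=0\}$. -/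

import Mathlib

open MeasureTheory Set
open scoped ContDiff

noncomputable section

namespace Vlasov

/-! ### The complex Sobolev space `W^{1,1}(ℝ)` -/

/-- `g` is a weak derivative of `f` on the real line. It is only used for integrable `f`, `g`, so
both integrals converge. -/
def HasWeakDeriv (f g : ℝ → ℂ) : Prop :=
  ∀ φ : ℝ → ℝ, ContDiff ℝ ∞ φ → HasCompactSupport φ →
    ∫ x, deriv φ x • f x = -∫ x, φ x • g x

/-- The function `f` belongs to `W^{1,1}(ℝ)`: it is integrable and has an integrable weak
derivative. -/
def MemW11 (f : ℝ → ℂ) : Prop :=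
  Integrable f ∧ ∃ g : ℝ → ℂ, Integrable g ∧ HasWeakDeriv f g

lemma integrable_smul_of_test {φ : ℝ → ℝ} (hφ : Continuous φ) (hc : HasCompactSupport φ)
    {f : ℝ → ℂ} (hf : Integrable f) : Integrable fun x => φ x • f x := by
  obtain ⟨C, hC⟩ := hφ.bounded_above_of_compact_support hc
  exact hf.bdd_smul C hφ.aestronglyMeasurable (Filter.Eventually.of_forall hC)

lemma integrable_deriv_smul_of_test {φ : ℝ → ℝ} (hφ : ContDiff ℝ ∞ φ) (hc : HasCompactSupport φ)
    {f : ℝ → ℂ} (hf : Integrable f) : Integrable fun x => deriv φ x • f x :=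
  integrable_smul_of_test (hφ.continuous_deriv (by norm_num)) hc.deriv hf

lemma HasWeakDeriv.congr {f g f₁ g₁ : ℝ → ℂ} (h : HasWeakDeriv f g) (hf : f =ᵐ[volume] f₁)
    (hg : g =ᵐ[volume] g₁) : HasWeakDeriv f₁ g₁ := by
  intro φ hφ hc
  have h1 : ∫ x, deriv φ x • f₁ x = ∫ x, deriv φ x • f x :=
    integral_congr_ae (by filter_upwards [hf] with x hx; rw [hx])
  have h2 : ∫ x, φ x • g₁ x = ∫ x, φ x • g x :=
    integral_congr_ae (by filter_upwards [hg] with x hx; rw [hx])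
  rw [h1, h2, h φ hφ hc]

lemma HasWeakDeriv.add {f g f₁ g₁ : ℝ → ℂ} (h : HasWeakDeriv f g) (h₁ : HasWeakDeriv f₁ g₁)
    (hf : Integrable f) (hg : Integrable g) (hf₁ : Integrable f₁) (hg₁ : Integrable g₁) :
    HasWeakDeriv (f + f₁) (g + g₁) := by
  intro φ hφ hc
  simp only [Pi.add_apply, smul_add]
  rw [integral_add (integrable_deriv_smul_of_test hφ hc hf)
      (integrable_deriv_smul_of_test hφ hc hf₁),
    integral_add (integrable_smul_of_test hφ.continuous hc hg)
      (integrable_smul_of_test hφ.continuous hc hg₁), h φ hφ hc, h₁ φ hφ hc, neg_add]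

lemma HasWeakDeriv.const_smul {f g : ℝ → ℂ} (h : HasWeakDeriv f g) (c : ℂ) :
    HasWeakDeriv (c • f) (c • g) := by
  intro φ hφ hc
  simp only [Pi.smul_apply, smul_comm _ c]
  rw [integral_smul, integral_smul, h φ hφ hc, smul_neg]

lemma HasWeakDeriv.zero : HasWeakDeriv 0 0 := by
  intro φ _ _
  simp

lemma MemW11.congr {f f₁ : ℝ → ℂ} (h : MemW11 f) (hf : f =ᵐ[volume] f₁) : MemW11 f₁ := by
  obtain ⟨h0, g, hg, hw⟩ := h
  exact ⟨h0.congr hf, g, hg, hw.congr hf (Filter.EventuallyEq.refl _ _)⟩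

lemma MemW11.add {f f₁ : ℝ → ℂ} (h : MemW11 f) (h₁ : MemW11 f₁) : MemW11 (f + f₁) := by
  obtain ⟨h0, g, hg, hw⟩ := h
  obtain ⟨h0₁, g₁, hg₁, hw₁⟩ := h₁
  exact ⟨h0.add h0₁, g + g₁, hg.add hg₁, hw.add hw₁ h0 hg h0₁ hg₁⟩

lemma MemW11.const_smul {f : ℝ → ℂ} (h : MemW11 f) (c : ℂ) : MemW11 (c • f) := by
  obtain ⟨h0, g, hg, hw⟩ := h
  exact ⟨h0.smul c, c • g, hg.smul c, hw.const_smul c⟩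

lemma MemW11.zero : MemW11 0 :=
  ⟨integrable_zero _ _ _, 0, integrable_zero _ _ _, HasWeakDeriv.zero⟩

/-- `L¹(ℝ; ℂ)`. -/
abbrev L1 : Type := Lp ℂ 1 (volume : Measure ℝ)

/-- `W^{1,1}(ℝ)` as a subspace of `L¹ × L¹` with norm `‖f‖₁ + ‖g‖₁`, an element being the pair of
a function and its weak derivative. -/
def sobolevSubmodule : Submodule ℂ (WithLp 1 (L1 × L1)) where
  carrier := {F | HasWeakDeriv F.fst F.snd}
  add_mem' {F G} hF hG := by
    exact (HasWeakDeriv.add hF hG (L1.integrable_coeFn _) (L1.integrable_coeFn _)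
      (L1.integrable_coeFn _) (L1.integrable_coeFn _)).congr
        (Lp.coeFn_add F.fst G.fst).symm (Lp.coeFn_add F.snd G.snd).symm
  zero_mem' := HasWeakDeriv.zero.congr (Lp.coeFn_zero ℂ 1 volume).symm
    (Lp.coeFn_zero ℂ 1 volume).symm
  smul_mem' c F hF := by
    exact (HasWeakDeriv.const_smul hF c).congr
      (Lp.coeFn_smul c F.fst).symm (Lp.coeFn_smul c F.snd).symm

/-- The space `W^{1,1}(ℝ)` with the norm `‖f‖_{1,1} = ‖f‖₁ + ‖f'‖₁`. -/
abbrev W11 : Type := ↥sobolevSubmodule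

/-- The function underlying an element of `W^{1,1}(ℝ)` (a representative of its class). -/
def W11.fn (F : W11) : ℝ → ℂ := F.1.fst

/-- The weak derivative of an element of `W^{1,1}(ℝ)`. -/
def W11.fn' (F : W11) : ℝ → ℂ := F.1.snd

lemma W11.integrable_fn (F : W11) : Integrable F.fn := L1.integrable_coeFn _

lemma W11.memW11 (F : W11) : MemW11 F.fn :=
  ⟨L1.integrable_coeFn _, F.fn', L1.integrable_coeFn _, F.2⟩

lemma W11.norm_eq (F : W11) : ‖F‖ = (∫ x, ‖F.fn x‖) + ∫ x, ‖F.fn' x‖ := by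
  have h : ‖F‖ = ‖F.1.fst‖ + ‖F.1.snd‖ := by
    rw [Submodule.coe_norm, WithLp.prod_norm_eq_add (by simp)]
    simp
  rw [h, L1.norm_eq_integral_norm, L1.norm_eq_integral_norm]
  rfl

lemma W11.fn_add (F G : W11) : (F + G).fn =ᵐ[volume] F.fn + G.fn := Lp.coeFn_add _ _

lemma W11.fn_smul (c : ℂ) (F : W11) : (c • F).fn =ᵐ[volume] c • F.fn := Lp.coeFn_smul _ _

lemma W11.fn_zero : (0 : W11).fn =ᵐ[volume] 0 := Lp.coeFn_zero _ _ _

/-- Weak derivatives are unique, so an element of `W^{1,1}(ℝ)` is determined by its function. -/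
lemma W11.ext_fn {F G : W11} (h : F.fn =ᵐ[volume] G.fn) : F = G := by
  have h1 : F.1.fst = G.1.fst := Lp.ext h
  have h2 : F.1.snd = G.1.snd := by
    refine Lp.ext ?_
    refine ae_eq_of_integral_contDiff_smul_eq (L1.integrable_coeFn _).locallyIntegrable
      (L1.integrable_coeFn _).locallyIntegrable ?_
    intro φ hφ hc
    have hF := F.2 φ hφ hc
    have hG := G.2 φ hφ hc
    rw [h1] at hF
    exact neg_injective (hF.symm.trans hG)
  apply Subtype.ext
  apply WithLp.ofLp_injective
  exact Prod.ext h1 h2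

/-- The element of `W^{1,1}(ℝ)` given by a function. -/
def MemW11.toW11 {f : ℝ → ℂ} (h : MemW11 f) : W11 :=
  ⟨WithLp.toLp 1 (h.1.toL1 f, h.2.choose_spec.1.toL1 h.2.choose),
    h.2.choose_spec.2.congr h.1.coeFn_toL1.symm h.2.choose_spec.1.coeFn_toL1.symm⟩

lemma MemW11.fn_toW11 {f : ℝ → ℂ} (h : MemW11 f) : h.toW11.fn =ᵐ[volume] f := h.1.coeFn_toL1

/-! ### The operator -/

lemma ofReal_mul_fn_add (F G : W11) :
    (fun v : ℝ => (v : ℂ) * (F + G).fn v) =ᵐ[volume]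
      (fun v : ℝ => (v : ℂ) * F.fn v) + fun v : ℝ => (v : ℂ) * G.fn v := by
  filter_upwards [W11.fn_add F G] with v hv
  simp [hv, mul_add]

lemma ofReal_mul_fn_smul (c : ℂ) (F : W11) :
    (fun v : ℝ => (v : ℂ) * (c • F).fn v) =ᵐ[volume] c • fun v : ℝ => (v : ℂ) * F.fn v := by
  filter_upwards [W11.fn_smul c F] with v hv
  simp [hv, mul_left_comm]

/-- The domain `{f ∈ W^{1,1} : v f ∈ W^{1,1}}`. -/
def velocityDomain : Submodule ℂ W11 where
  carrier := {F | MemW11 fun v : ℝ => (v : ℂ) * F.fn v}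
  add_mem' {F G} hF hG := (MemW11.add hF hG).congr (ofReal_mul_fn_add F G).symm
  zero_mem' := MemW11.zero.congr (by
    filter_upwards [W11.fn_zero] with v hv
    simp [hv])
  smul_mem' c F hF := (MemW11.const_smul hF c).congr (ofReal_mul_fn_smul c F).symm

/-- Multiplication by the velocity, `f ↦ v f`, with domain `{f ∈ W^{1,1} : v f ∈ W^{1,1}}`. -/
def velocityMul : W11 →ₗ.[ℂ] W11 where
  domain := velocityDomain
  toFun :=
    { toFun := fun F => MemW11.toW11 F.2
      map_add' := fun F G => W11.ext_fn <| by
        filter_upwards [MemW11.fn_toW11 (F + G).2, MemW11.fn_toW11 F.2, MemW11.fn_toW11 G.2,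
          W11.fn_add (MemW11.toW11 F.2) (MemW11.toW11 G.2), ofReal_mul_fn_add F.1 G.1]
          with v h1 h2 h3 h4 h5
        rw [h1, h4, Pi.add_apply, h2, h3]
        exact h5
      map_smul' := fun c F => W11.ext_fn <| by
        filter_upwards [MemW11.fn_toW11 (c • F).2, MemW11.fn_toW11 F.2,
          W11.fn_smul c (MemW11.toW11 F.2), ofReal_mul_fn_smul c F.1] with v h1 h2 h3 h4
        rw [h1, RingHom.id_apply, h3, Pi.smul_apply, h2]
        exact h4 }

/-- The functional `f ↦ ∫ f dv` on `W^{1,1}(ℝ)`. -/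
def integralFunctional : W11 →ₗ[ℂ] ℂ where
  toFun F := ∫ v, F.fn v
  map_add' F G := by
    rw [integral_congr_ae (W11.fn_add F G)]
    exact integral_add F.integrable_fn G.integrable_fn
  map_smul' c F := by
    rw [integral_congr_ae (W11.fn_smul c F)]
    exact integral_smul c F.fn

/-- The operator `T f = i v f - i k⁻² g ∫ f dv` in `W^{1,1}(ℝ)` with domain
`{f ∈ W^{1,1} : v f ∈ W^{1,1}}`, where `g ∈ W^{1,1}(ℝ)` (to be taken as `f₀'`). -/
def vlasovOperator (k : ℝ) (g : W11) : W11 →ₗ.[ℂ] W11 where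
  domain := velocityMul.domain
  toFun := Complex.I • velocityMul.toFun -
    (LinearMap.toSpanSingleton ℂ W11 ((Complex.I * ((k : ℂ) ^ 2)⁻¹) • g)) ∘ₗ
      integralFunctional ∘ₗ velocityMul.domain.subtype

lemma vlasovOperator_fn (k : ℝ) (g : W11) (F : (vlasovOperator k g).domain) :
    (vlasovOperator k g F).fn =ᵐ[volume] fun v : ℝ =>
      Complex.I * v * F.1.fn v - Complex.I * ((k : ℂ) ^ 2)⁻¹ * g.fn v * ∫ w, F.1.fn w := by
  have key : vlasovOperator k g F = Complex.I • MemW11.toW11 F.2 +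
      (-((∫ w, F.1.fn w) * (Complex.I * ((k : ℂ) ^ 2)⁻¹))) • g := by
    rw [neg_smul, ← sub_eq_add_neg, mul_smul]
    rfl
  rw [key]
  filter_upwards [W11.fn_add (Complex.I • MemW11.toW11 F.2)
      ((-((∫ w, F.1.fn w) * (Complex.I * ((k : ℂ) ^ 2)⁻¹))) • g),
    W11.fn_smul Complex.I (MemW11.toW11 F.2),
    W11.fn_smul (-((∫ w, F.1.fn w) * (Complex.I * ((k : ℂ) ^ 2)⁻¹))) g,
    MemW11.fn_toW11 F.2] with v h1 h2 h3 h4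
  rw [h1, Pi.add_apply, h2, h3, Pi.smul_apply, Pi.smul_apply, h4, smul_eq_mul, smul_eq_mul]
  ring

/-! ### The spectrum of an unbounded operator and its parts -/

section Spectrum

variable {E : Type*} [NormedAddCommGroup E] [NormedSpace ℂ E]

/-- `T - λ I`, on the domain of `T`. -/
def shifted (T : E →ₗ.[ℂ] E) (z : ℂ) : T.domain →ₗ[ℂ] E :=
  T.toFun - z • T.domain.subtype

/-- The spectrum: all `z` for which `T - z I` has no bounded inverse defined on all of `E`. -/
def spectrum (T : E →ₗ.[ℂ] E) : Set ℂ :=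
  {z | ¬ ∃ R : E →L[ℂ] E, (∀ x : T.domain, R (shifted T z x) = x) ∧
    ∀ y : E, ∃ x : T.domain, (x : E) = R y ∧ shifted T z x = y}

/-- The point spectrum: `T - z I` is not injective. -/
def pointSpectrum (T : E →ₗ.[ℂ] E) : Set ℂ :=
  {z | ¬ Function.Injective (shifted T z)}

/-- The residual spectrum: the resolvent `(T - z I)⁻¹` exists, but its domain, the range of
`T - z I`, is not dense. -/
def residualSpectrum (T : E →ₗ.[ℂ] E) : Set ℂ :=
  {z | Function.Injective (shifted T z) ∧ ¬ Dense (range (shifted T z))}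

/-- The continuous spectrum: the resolvent `(T - z I)⁻¹` exists and is densely defined, but it is
unbounded. -/
def continuousSpectrum (T : E →ₗ.[ℂ] E) : Set ℂ :=
  {z | Function.Injective (shifted T z) ∧ Dense (range (shifted T z)) ∧
    ¬ ∃ C : ℝ, ∀ x : T.domain, ‖(x : E)‖ ≤ C * ‖shifted T z x‖}

end Spectrum

/-! ### The dispersion relation -/

/-- The integrand `f₀'(v) / (v - u)` for complex `u`. -/
def dispersionIntegrand (f₀ : ℝ → ℝ) (u : ℂ) (v : ℝ) : ℂ := ((deriv f₀ v : ℝ) : ℂ) / ((v : ℂ) - u)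

/-- The relation `1 - k⁻² ∫ f₀'(v) / (v - u) dv = 0`, including the convergence of the integral. -/
def DispersionRelation (k : ℝ) (f₀ : ℝ → ℝ) (u : ℂ) : Prop :=
  Integrable (dispersionIntegrand f₀ u) ∧
    1 - ((k : ℂ) ^ 2)⁻¹ * ∫ v, dispersionIntegrand f₀ u v = 0

/-- `f₀` is of class `C²` near `u` and `f₀''` is Hölder continuous at `u`. -/
def HolderC2At (f₀ : ℝ → ℝ) (u : ℝ) : Prop :=
  ContDiffAt ℝ 2 f₀ u ∧ ∃ α > (0 : ℝ), ∃ C : ℝ, ∀ᶠ v in nhds u,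
    |deriv (deriv f₀) v - deriv (deriv f₀) u| ≤ C * |v - u| ^ α

end Vlasov

end

open Filter Topology

noncomputable section

namespace Vlasov

/-! ### Weak derivatives -/

/-! Writing `λ = iu`, the operator `T - λ` becomes `f ↦ i((v - u) f - k⁻² (∫ f) f₀')`: a
multiplication operator with a rank-one perturbation. Everything reduces to dividing by `v - u`
inside `W^{1,1}`.

An eigenfunction has nonzero integral and is a multiple of `f₀'/(v - u)`; integrating it gives the
dispersion relation. Conversely, this quotient is an eigenfunction once it lies in `W^{1,1}`. For
nonreal `u` this is automatic, because `1/(v - u)` is a bounded smooth multiplier; for real `u` the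
Hölder condition allows the linear Taylor part of `f₀'` to be split off (`memW11_deriv_div_sub`). If
`u` is nonreal and the relation fails, the rank-one perturbation formula gives a bounded resolvent
(`notMem_spectrum`). Thus the rest of the spectrum lies on the imaginary axis.

For real `u`, mean-zero functions concentrating at `u` show that the inverse is never bounded
(`not_exists_bound_shifted`). Point evaluation is continuous on `W^{1,1}` and `(v - u) f` vanishes
at `u`; so if `f₀'(u) = 0`, the range stays in a proper closed hyperplane
(`not_dense_range_shifted`). If `f₀'(u) ≠ 0`, the functions `(v - u) f` are dense in that hyperplane
(`exists_divisible_near`), while `∫ f` can be prescribed at arbitrarily small cost in `‖(v - u) f‖`,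
by the logarithmic divergence of `∫ dv/|v - u|` (`exists_integral_eq_one_near`). The rank-one term
then supplies the missing direction `f₀'`, and the range is dense (`dense_range_shifted`). -/

lemma HasWeakDeriv.of_hasDerivAt {f g : ℝ → ℂ} (h : ∀ x, HasDerivAt f (g x) x)
    (hf : Integrable f) (hg : Integrable g) : HasWeakDeriv f g := by
  intro φ hφ hc
  have hd : ∀ x, HasDerivAt φ (deriv φ x) x :=
    fun x => (hφ.differentiable (by simp) x).hasDerivAt
  have key := integral_bilinear_hasDerivAt_right_eq_neg_left_of_integrable
    (L := ContinuousLinearMap.lsmul ℝ ℝ) (u := φ) (v := f) (u' := deriv φ) (v' := g)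
    (fun x _ => hd x) (fun x _ => h x)
    (by simpa using integrable_smul_of_test hφ.continuous hc hg)
    (by simpa using integrable_deriv_smul_of_test hφ hc hf)
    (by simpa using integrable_smul_of_test hφ.continuous hc hf)
  simp only [ContinuousLinearMap.lsmul_apply] at key
  rw [key, neg_neg]

/-- The defining identity of weak derivatives for complex test functions. -/
lemma HasWeakDeriv.integral_deriv_mul {f g : ℝ → ℂ} (h : HasWeakDeriv f g)
    (hf : Integrable f) (hg : Integrable g) {φ : ℝ → ℂ} (hφ : ContDiff ℝ ∞ φ)
    (hc : HasCompactSupport φ) : ∫ x, deriv φ x * f x = -∫ x, φ x * g x := by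
  have hr : ContDiff ℝ ∞ fun x => (φ x).re := Complex.reCLM.contDiff.comp hφ
  have hi : ContDiff ℝ ∞ fun x => (φ x).im := Complex.imCLM.contDiff.comp hφ
  have hcr : HasCompactSupport fun x => (φ x).re := hc.comp_left (g := Complex.re) rfl
  have hci : HasCompactSupport fun x => (φ x).im := hc.comp_left (g := Complex.im) rfl
  have hd : ∀ x, HasDerivAt φ (deriv φ x) x :=
    fun x => (hφ.differentiable (by simp) x).hasDerivAt
  have hdr : ∀ x, deriv (fun x => (φ x).re) x = (deriv φ x).re := fun x =>
    (Complex.reCLM.hasFDerivAt.comp_hasDerivAt x (hd x)).deriv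
  have hdi : ∀ x, deriv (fun x => (φ x).im) x = (deriv φ x).im := fun x =>
    (Complex.imCLM.hasFDerivAt.comp_hasDerivAt x (hd x)).deriv
  have e1 : ∀ x, deriv φ x * f x = deriv (fun x => (φ x).re) x • f x +
      Complex.I * (deriv (fun x => (φ x).im) x • f x) := by
    intro x
    rw [hdr, hdi, Complex.real_smul, Complex.real_smul]
    conv_lhs => rw [← Complex.re_add_im (deriv φ x)]
    ring
  have e2 : ∀ x, φ x * g x = (φ x).re • g x + Complex.I * ((φ x).im • g x) := by
    intro x
    rw [Complex.real_smul, Complex.real_smul]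
    conv_lhs => rw [← Complex.re_add_im (φ x)]
    ring
  simp only [e1, e2]
  rw [integral_add (integrable_deriv_smul_of_test hr hcr hf)
      ((integrable_deriv_smul_of_test hi hci hf).const_mul _),
    integral_add (integrable_smul_of_test hr.continuous hcr hg)
      ((integrable_smul_of_test hi.continuous hci hg).const_mul _),
    integral_const_mul, integral_const_mul, h _ hr hcr, h _ hi hci]
  ring

/-- Leibniz rule for the product with a smooth function. -/
lemma HasWeakDeriv.mul_left {f g ψ : ℝ → ℂ} (h : HasWeakDeriv f g)
    (hf : Integrable f) (hg : Integrable g) (hψ : ContDiff ℝ ∞ ψ) :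
    HasWeakDeriv (fun x => ψ x * f x) (fun x => ψ x * g x + deriv ψ x * f x) := by
  intro φ hφ hc
  have hφ' : ContDiff ℝ ∞ fun x => φ x • ψ x := hφ.smul hψ
  have hc' : HasCompactSupport fun x => φ x • ψ x := hc.smul_right
  have hdψ : Continuous (deriv ψ) := hψ.continuous_deriv (by norm_num)
  have hd : ∀ x, deriv (fun x => φ x • ψ x) x = φ x • deriv ψ x + deriv φ x • ψ x := fun x =>
    ((hφ.differentiable (by simp) x).hasDerivAt.smul
      (hψ.differentiable (by simp) x).hasDerivAt).deriv
  have bdd : ∀ {χ F : ℝ → ℂ}, Continuous χ → HasCompactSupport χ → Integrable F →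
      Integrable fun x => χ x * F x := by
    intro χ F h1 h2 h3
    obtain ⟨C, hC⟩ := h1.bounded_above_of_compact_support h2
    exact h3.bdd_mul h1.aestronglyMeasurable (Eventually.of_forall hC)
  have i1 : Integrable fun x => (φ x • deriv ψ x) * f x :=
    bdd (hφ.continuous.smul hdψ) hc.smul_right hf
  have i2 : Integrable fun x => (deriv φ x • ψ x) * f x :=
    bdd ((hφ.continuous_deriv (by norm_num)).smul hψ.continuous) hc.deriv.smul_right hf
  have i3 : Integrable fun x => (φ x • ψ x) * g x := bdd hφ'.continuous hc' hg
  have key := h.integral_deriv_mul hf hg hφ' hc'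
  simp only [hd, add_mul] at key
  rw [integral_add i1 i2] at key
  have e1 : ∀ x, deriv φ x • (ψ x * f x) = (deriv φ x • ψ x) * f x := fun x =>
    (smul_mul_assoc _ _ _).symm
  have e2 : ∀ x, φ x • (ψ x * g x + deriv ψ x * f x) =
      (φ x • ψ x) * g x + (φ x • deriv ψ x) * f x := fun x => by
    rw [smul_add, smul_mul_assoc, smul_mul_assoc]
  simp only [e1, e2]
  rw [integral_add i3 i1]
  linear_combination key

/-- Smooth cutoff functions exhausting the line, with uniformly bounded derivatives. -/
lemma exists_cutoff : ∃ χ : ℕ → ℝ → ℝ, (∀ n, ContDiff ℝ ∞ (χ n)) ∧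
    (∀ n, HasCompactSupport (χ n)) ∧ (∀ n x, ‖χ n x‖ ≤ 1) ∧
    (∃ C, ∀ n x, ‖deriv (χ n) x‖ ≤ C) ∧ (∀ x, Tendsto (fun n => χ n x) atTop (𝓝 1)) ∧
    ∀ x, Tendsto (fun n => deriv (χ n) x) atTop (𝓝 0) := by
  let b : ContDiffBump (0 : ℝ) := ⟨1, 2, one_pos, one_lt_two⟩
  have hb : ContDiff ℝ ∞ b := b.contDiff
  have hpos : ∀ n : ℕ, (0 : ℝ) < ((n : ℝ) + 1)⁻¹ := fun n => by positivity
  have hder : ∀ (n : ℕ) x, deriv (fun x => b (((n : ℝ) + 1)⁻¹ * x)) x =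
      ((n : ℝ) + 1)⁻¹ * deriv b (((n : ℝ) + 1)⁻¹ * x) := fun n x => by
    simpa using deriv_comp_mul_left (((n : ℝ) + 1)⁻¹) b x
  obtain ⟨C, hC⟩ := (hb.continuous_deriv (by norm_num)).bounded_above_of_compact_support
    b.hasCompactSupport.deriv
  have hbound : ∀ (n : ℕ) x, ‖deriv (fun x => b (((n : ℝ) + 1)⁻¹ * x)) x‖ ≤
      ((n : ℝ) + 1)⁻¹ * C := fun n x => by
    rw [hder, norm_mul, Real.norm_of_nonneg (hpos n).le]
    exact mul_le_mul_of_nonneg_left (hC _) (hpos n).le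
  have hlim : Tendsto (fun n : ℕ => ((n : ℝ) + 1)⁻¹) atTop (𝓝 0) := by
    simpa using tendsto_one_div_add_atTop_nhds_zero_nat (𝕜 := ℝ)
  refine ⟨fun n x => b (((n : ℝ) + 1)⁻¹ * x), fun n => hb.comp (contDiff_const.mul contDiff_id),
    fun n => ?_, fun n x => ?_, ⟨C, fun n x => (hbound n x).trans ?_⟩, fun x => ?_, fun x => ?_⟩
  · exact b.hasCompactSupport.comp_homeomorph (Homeomorph.mulLeft₀ _ (hpos n).ne')
  · rw [Real.norm_of_nonneg b.nonneg]
    exact b.le_one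
  · refine mul_le_of_le_one_left ((norm_nonneg _).trans (hC 0)) ?_
    exact inv_le_one_of_one_le₀ (by linarith [n.cast_nonneg (α := ℝ)])
  · have h1 : Tendsto (fun n : ℕ => b (((n : ℝ) + 1)⁻¹ * x)) atTop (𝓝 (b (0 * x))) :=
      (b.continuous.tendsto _).comp (hlim.mul_const x)
    rwa [zero_mul, b.one_of_mem_closedBall (Metric.mem_closedBall_self b.rIn_pos.le)] at h1
  · refine squeeze_zero_norm (fun n => hbound n x) ?_
    simpa using hlim.mul_const C

/-- The integral of an integrable weak derivative vanishes. -/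
lemma HasWeakDeriv.integral_eq_zero {f g : ℝ → ℂ} (h : HasWeakDeriv f g)
    (hf : Integrable f) (hg : Integrable g) : ∫ x, g x = 0 := by
  obtain ⟨χ, h1, h2, h3, ⟨C, h4⟩, h5, h6⟩ := exists_cutoff
  -- The dilated cutoffs replace the inadmissible test function `1`; their derivatives tend to `0`
  -- boundedly.
  have t1 : Tendsto (fun n => ∫ x, χ n x • g x) atTop (𝓝 (∫ x, (1 : ℝ) • g x)) := by
    refine tendsto_integral_of_dominated_convergence (fun x => ‖g x‖)
      (fun n => (integrable_smul_of_test (h1 n).continuous (h2 n) hg).aestronglyMeasurable)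
      hg.norm (fun n => Eventually.of_forall fun x => ?_)
      (Eventually.of_forall fun x => (h5 x).smul_const _)
    rw [norm_smul]
    exact mul_le_of_le_one_left (norm_nonneg _) (h3 n x)
  have t2 : Tendsto (fun n => ∫ x, deriv (χ n) x • f x) atTop (𝓝 (∫ x, (0 : ℝ) • f x)) := by
    refine tendsto_integral_of_dominated_convergence (fun x => C * ‖f x‖)
      (fun n => (integrable_deriv_smul_of_test (h1 n) (h2 n) hf).aestronglyMeasurable)
      (hf.norm.const_mul C) (fun n => Eventually.of_forall fun x => ?_)
      (Eventually.of_forall fun x => (h6 x).smul_const _)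
    rw [norm_smul]
    exact mul_le_mul_of_nonneg_right (h4 n x) (norm_nonneg _)
  have t3 : Tendsto (fun n => ∫ x, deriv (χ n) x • f x) atTop (𝓝 (-∫ x, (1 : ℝ) • g x)) := by
    rw [funext fun n => h (χ n) (h1 n) (h2 n)]
    exact t1.neg
  have key := tendsto_nhds_unique t2 t3
  simp only [zero_smul, integral_zero, one_smul] at key
  exact neg_eq_zero.1 key.symm

/-- A smooth compactly supported function has a bounded smooth primitive. -/
lemma exists_primitive {φ : ℝ → ℝ} (hφ : ContDiff ℝ ∞ φ) (hc : HasCompactSupport φ) :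
    ContDiff ℝ ∞ (fun x => ∫ t in Iic x, φ t) ∧
      (∀ x, HasDerivAt (fun x => ∫ t in Iic x, φ t) (φ x) x) ∧
      ∀ x, ‖∫ t in Iic x, φ t‖ ≤ ∫ t, ‖φ t‖ := by
  have hi : Integrable φ := hφ.continuous.integrable_of_hasCompactSupport hc
  have hd : ∀ x, HasDerivAt (fun x => ∫ t in Iic x, φ t) (φ x) x := by
    intro x
    have h1 : ∀ y, ∫ t in Iic y, φ t = (∫ t in Iic (0 : ℝ), φ t) + ∫ t in (0 : ℝ)..y, φ t := by
      intro y
      rw [← intervalIntegral.integral_Iic_sub_Iic hi.integrableOn hi.integrableOn]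
      ring
    rw [funext h1]
    exact (hφ.continuous.integral_hasStrictDerivAt 0 x).hasDerivAt.const_add _
  refine ⟨?_, hd, fun x => (norm_integral_le_integral_norm _).trans
    (setIntegral_le_integral hi.norm (Eventually.of_forall fun _ => norm_nonneg _))⟩
  rw [contDiff_infty_iff_deriv]
  refine ⟨fun x => (hd x).differentiableAt, ?_⟩
  rwa [funext fun x => (hd x).deriv]

/-- The absolutely continuous representative of a function with weak derivative `g`. -/
def primitive (g : ℝ → ℂ) (y : ℝ) : ℂ := -∫ x in Ioi y, g x

lemma norm_primitive_le {g : ℝ → ℂ} (hg : Integrable g) (y : ℝ) :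
    ‖primitive g y‖ ≤ ∫ x, ‖g x‖ := by
  rw [primitive, norm_neg]
  exact (norm_integral_le_integral_norm _).trans
    (setIntegral_le_integral hg.norm (Eventually.of_forall fun _ => norm_nonneg _))

lemma primitive_sub_eq_intervalIntegral {g : ℝ → ℂ} (hg : Integrable g) (a y : ℝ) :
    primitive g y = primitive g a + ∫ x in a..y, g x := by
  rw [primitive, primitive,
    ← intervalIntegral.integral_Ioi_sub_Ioi' hg.integrableOn hg.integrableOn]
  ring

lemma continuous_primitive {g : ℝ → ℂ} (hg : Integrable g) : Continuous (primitive g) := by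
  rw [funext fun y => primitive_sub_eq_intervalIntegral hg 0 y]
  exact continuous_const.add
    (intervalIntegral.continuous_primitive (fun _ _ => hg.intervalIntegrable) 0)

lemma ae_hasDerivAt_primitive {g : ℝ → ℂ} (hg : Integrable g) :
    ∀ᵐ x, HasDerivAt (primitive g) (g x) x := by
  filter_upwards [_root_.LocallyIntegrable.ae_hasDerivAt_integral hg.locallyIntegrable] with x hx
  rw [funext fun y => primitive_sub_eq_intervalIntegral hg 0 y]
  exact (hx 0).const_add _

/-- The primitive `Φ` of a test function `φ` is bounded but need not have compact support, so it is
used as a multiplier: `Φ f` has weak derivative `Φ g + φ f`, whose integral vanishes. Fubini on `{y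
≤ x}` turns `∫ Φ g` into minus the integral of `φ` against the primitive of `g`. -/
lemma HasWeakDeriv.ae_eq_primitive {f g : ℝ → ℂ} (h : HasWeakDeriv f g)
    (hf : Integrable f) (hg : Integrable g) : f =ᵐ[volume] primitive g := by
  refine ae_eq_of_integral_contDiff_smul_eq hf.locallyIntegrable
    (continuous_primitive hg).locallyIntegrable fun φ hφ hc => ?_
  have hφi : Integrable φ := hφ.continuous.integrable_of_hasCompactSupport hc
  obtain ⟨hΦ, hd, hb⟩ := exists_primitive hφ hc
  set Φ : ℝ → ℝ := fun x => ∫ t in Iic x, φ t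
  have hΨ : ContDiff ℝ ∞ fun x => (Φ x : ℂ) := Complex.ofRealCLM.contDiff.comp hΦ
  have hΨd : ∀ x, deriv (fun x => (Φ x : ℂ)) x = (φ x : ℂ) := fun x => (hd x).ofReal_comp.deriv
  have i1 : Integrable fun x => (Φ x : ℂ) * g x :=
    hg.bdd_mul (c := ∫ t, ‖φ t‖) hΨ.continuous.aestronglyMeasurable
      (Eventually.of_forall fun x => by rw [Complex.norm_real]; exact hb x)
  have i2 : Integrable fun x => (φ x : ℂ) * f x := by
    simpa only [Complex.real_smul] using integrable_smul_of_test hφ.continuous hc hf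
  have i3 : Integrable fun x => (Φ x : ℂ) * f x :=
    hf.bdd_mul (c := ∫ t, ‖φ t‖) hΨ.continuous.aestronglyMeasurable
      (Eventually.of_forall fun x => by rw [Complex.norm_real]; exact hb x)
  have key := h.mul_left hf hg hΨ
  simp only [hΨd] at key
  have key2 := key.integral_eq_zero i3 (i1.add i2)
  rw [integral_add i1 i2] at key2
  have hp : Integrable (fun p : ℝ × ℝ => (φ p.1 : ℂ) * g p.2) (volume.prod volume) :=
    hφi.ofReal.mul_prod hg
  have hs : MeasurableSet {p : ℝ × ℝ | p.1 ≤ p.2} := measurableSet_le measurable_fst measurable_snd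
  have swap := integral_integral_swap (f := fun y x => {p : ℝ × ℝ | p.1 ≤ p.2}.indicator
    (fun p : ℝ × ℝ => (φ p.1 : ℂ) * g p.2) (y, x)) (by exact hp.indicator hs)
  have l1 : ∀ y, ∫ x, {p : ℝ × ℝ | p.1 ≤ p.2}.indicator
      (fun p : ℝ × ℝ => (φ p.1 : ℂ) * g p.2) (y, x) = -(φ y • primitive g y) := by
    intro y
    rw [primitive, smul_neg, neg_neg, ← integral_Ici_eq_integral_Ioi, Complex.real_smul,
      ← integral_const_mul, ← integral_indicator measurableSet_Ici]
    rfl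
  have l2 : ∀ x, ∫ y, {p : ℝ × ℝ | p.1 ≤ p.2}.indicator
      (fun p : ℝ × ℝ => (φ p.1 : ℂ) * g p.2) (y, x) = (Φ x : ℂ) * g x := by
    intro x
    have : (Φ x : ℂ) = ∫ y in Iic x, (φ y : ℂ) := integral_ofReal.symm
    rw [this, ← integral_mul_const, ← integral_indicator measurableSet_Iic]
    rfl
  simp only [l1, l2] at swap
  rw [integral_neg] at swap
  have e : ∀ x, φ x • f x = (φ x : ℂ) * f x := fun x => Complex.real_smul
  simp only [e] at swap ⊢
  linear_combination key2 + swap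

lemma HasWeakDeriv.unique {f g₁ g₂ : ℝ → ℂ} (h₁ : HasWeakDeriv f g₁) (h₂ : HasWeakDeriv f g₂)
    (i₁ : Integrable g₁) (i₂ : Integrable g₂) : g₁ =ᵐ[volume] g₂ :=
  ae_eq_of_integral_contDiff_smul_eq i₁.locallyIntegrable i₂.locallyIntegrable
    fun φ hφ hc => neg_injective ((h₁ φ hφ hc).symm.trans (h₂ φ hφ hc))

/-- Weak derivatives pass to pointwise limits dominated by integrable functions. -/
lemma HasWeakDeriv.of_tendsto {F G : ℕ → ℝ → ℂ} {f g : ℝ → ℂ} {a b : ℝ → ℝ}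
    (h : ∀ n, HasWeakDeriv (F n) (G n))
    (hF : ∀ n, Integrable (F n)) (hG : ∀ n, Integrable (G n))
    (ha : Integrable a) (hb : Integrable b)
    (hFa : ∀ n, ∀ᵐ x, ‖F n x‖ ≤ a x) (hGb : ∀ n, ∀ᵐ x, ‖G n x‖ ≤ b x)
    (hf : ∀ᵐ x, Tendsto (fun n => F n x) atTop (𝓝 (f x)))
    (hg : ∀ᵐ x, Tendsto (fun n => G n x) atTop (𝓝 (g x))) : HasWeakDeriv f g := by
  intro φ hφ hc
  have lim : ∀ {φ : ℝ → ℝ} {F : ℕ → ℝ → ℂ} {f : ℝ → ℂ} {a : ℝ → ℝ}, Continuous φ →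
      HasCompactSupport φ → (∀ n, Integrable (F n)) → Integrable a →
      (∀ n, ∀ᵐ x, ‖F n x‖ ≤ a x) → (∀ᵐ x, Tendsto (fun n => F n x) atTop (𝓝 (f x))) →
      Tendsto (fun n => ∫ x, φ x • F n x) atTop (𝓝 (∫ x, φ x • f x)) := by
    intro φ F f a h1 h2 h3 h4 h5 h6
    obtain ⟨C, hC⟩ := h1.bounded_above_of_compact_support h2
    refine tendsto_integral_of_dominated_convergence (fun x => C * a x)
      (fun n => (integrable_smul_of_test h1 h2 (h3 n)).aestronglyMeasurable) (h4.const_mul C)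
      (fun n => ?_) (h6.mono fun x hx => hx.const_smul _)
    filter_upwards [h5 n] with x hx
    rw [norm_smul]
    exact mul_le_mul (hC x) hx (norm_nonneg _) ((norm_nonneg _).trans (hC x))
  have t1 := lim (hφ.continuous_deriv (by norm_num)) hc.deriv hF ha hFa hf
  have t2 := (lim hφ.continuous hc hG hb hGb hg).neg
  simp only [← fun n => h n φ hφ hc] at t2
  exact tendsto_nhds_unique t1 t2

/-! ### Elements of `W^{1,1}(ℝ)` -/

lemma W11.norm_eq_of_hasWeakDeriv {F : W11} {f g : ℝ → ℂ} (hf : F.fn =ᵐ[volume] f)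
    (h : HasWeakDeriv f g) (hg : Integrable g) : ‖F‖ = (∫ x, ‖f x‖) + ∫ x, ‖g x‖ := by
  have h' : F.fn' =ᵐ[volume] g :=
    HasWeakDeriv.unique (F.2.congr hf (EventuallyEq.refl _ _)) h (L1.integrable_coeFn _) hg
  rw [W11.norm_eq]
  exact congrArg₂ (· + ·) (integral_congr_ae (hf.fun_comp norm))
    (integral_congr_ae (h'.fun_comp norm))

lemma W11.integrable_fn' (F : W11) : Integrable F.fn' := L1.integrable_coeFn _

lemma W11.hasWeakDeriv (F : W11) : HasWeakDeriv F.fn F.fn' := F.2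

/-- The continuous representative of an element of `W^{1,1}(ℝ)`. -/
def W11.rep (F : W11) : ℝ → ℂ := primitive F.fn'

lemma W11.fn_ae_eq_rep (F : W11) : F.fn =ᵐ[volume] F.rep :=
  F.hasWeakDeriv.ae_eq_primitive F.integrable_fn F.integrable_fn'

lemma W11.continuous_rep (F : W11) : Continuous F.rep := continuous_primitive F.integrable_fn'

/-- Continuity of point evaluation; it provides the obstruction to density and lower bounds for
norms of concentrating functions. -/
lemma W11.norm_rep_le (F : W11) (x : ℝ) : ‖F.rep x‖ ≤ ‖F‖ := by
  refine (norm_primitive_le F.integrable_fn' x).trans ?_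
  rw [W11.norm_eq]
  exact le_add_of_nonneg_left (integral_nonneg fun _ => norm_nonneg _)

lemma W11.rep_eq {F : W11} {f : ℝ → ℂ} (h : F.fn =ᵐ[volume] f) (hf : Continuous f) :
    F.rep = f :=
  (F.continuous_rep.ae_eq_iff_eq volume hf).1 (F.fn_ae_eq_rep.symm.trans h)

lemma W11.rep_smul (c : ℂ) (F : W11) : (c • F).rep = c • F.rep :=
  W11.rep_eq ((W11.fn_smul c F).trans (F.fn_ae_eq_rep.const_smul c))
    (F.continuous_rep.const_smul c)

lemma W11.fn_sub (F G : W11) : (F - G).fn =ᵐ[volume] F.fn - G.fn := Lp.coeFn_sub _ _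

lemma W11.rep_sub (F G : W11) : (F - G).rep = F.rep - G.rep :=
  W11.rep_eq ((W11.fn_sub F G).trans (F.fn_ae_eq_rep.sub G.fn_ae_eq_rep))
    (F.continuous_rep.sub G.continuous_rep)

/-- The functional `f ↦ ∫ f dv` is bounded on `W^{1,1}(ℝ)`. -/
def integralCLM : W11 →L[ℂ] ℂ :=
  integralFunctional.mkContinuous 1 fun F => by
    rw [one_mul, W11.norm_eq]
    exact (norm_integral_le_integral_norm _).trans
      (le_add_of_nonneg_right (integral_nonneg fun _ => norm_nonneg _))

lemma integralCLM_apply (F : W11) : integralCLM F = ∫ v, F.fn v := rfl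

/-! ### Smooth multipliers -/

lemma integrable_mul_and_deriv {f g ψ : ℝ → ℂ} (hf : Integrable f) (hg : Integrable g)
    (hψ : ContDiff ℝ ∞ ψ) {A B : ℝ} (hA : ∀ x, ‖ψ x‖ ≤ A) (hB : ∀ x, ‖deriv ψ x‖ ≤ B) :
    Integrable (fun x => ψ x * f x) ∧ Integrable (fun x => ψ x * g x + deriv ψ x * f x) :=
  ⟨hf.bdd_mul hψ.continuous.aestronglyMeasurable (Eventually.of_forall hA),
    (hg.bdd_mul hψ.continuous.aestronglyMeasurable (Eventually.of_forall hA)).add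
      (hf.bdd_mul (hψ.continuous_deriv (by norm_num)).aestronglyMeasurable
        (Eventually.of_forall hB))⟩

/-- The exact norm is kept because the multipliers used at real points have derivatives of size `s`;
a bound by suprema would not be uniform in `s`. -/
lemma exists_smoothMul (F : W11) {ψ : ℝ → ℂ} (hψ : ContDiff ℝ ∞ ψ) {A B : ℝ}
    (hA : ∀ x, ‖ψ x‖ ≤ A) (hB : ∀ x, ‖deriv ψ x‖ ≤ B) :
    ∃ G : W11, G.fn =ᵐ[volume] (fun x => ψ x * F.fn x) ∧
      ‖G‖ = (∫ x, ‖ψ x * F.fn x‖) + ∫ x, ‖ψ x * F.fn' x + deriv ψ x * F.fn x‖ := by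
  obtain ⟨h1, h2⟩ := integrable_mul_and_deriv F.integrable_fn F.integrable_fn' hψ hA hB
  have h3 := F.hasWeakDeriv.mul_left F.integrable_fn F.integrable_fn' hψ
  have h4 : MemW11 fun x => ψ x * F.fn x := ⟨h1, _, h2, h3⟩
  exact ⟨h4.toW11, h4.fn_toW11, W11.norm_eq_of_hasWeakDeriv h4.fn_toW11 h3 h2⟩

lemma exists_smoothMul_clm {ψ : ℝ → ℂ} (hψ : ContDiff ℝ ∞ ψ) {A B : ℝ}
    (hA : ∀ x, ‖ψ x‖ ≤ A) (hB : ∀ x, ‖deriv ψ x‖ ≤ B) :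
    ∃ M : W11 →L[ℂ] W11, ∀ F, (M F).fn =ᵐ[volume] fun x => ψ x * F.fn x := by
  choose m hm hn using fun F => exists_smoothMul F hψ hA hB
  let M : W11 →ₗ[ℂ] W11 :=
    { toFun := m
      map_add' := fun F G => W11.ext_fn <| by
        filter_upwards [hm F, hm G, hm (F + G), W11.fn_add F G, W11.fn_add (m F) (m G)]
          with x h1 h2 h3 h4 h5
        rw [h3, h4, h5, Pi.add_apply, Pi.add_apply, h1, h2, mul_add]
      map_smul' := fun c F => W11.ext_fn <| by
        filter_upwards [hm F, hm (c • F), W11.fn_smul c F, W11.fn_smul c (m F)]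
          with x h1 h2 h3 h4
        rw [h2, h3, RingHom.id_apply, h4, Pi.smul_apply, Pi.smul_apply, h1, smul_eq_mul,
          smul_eq_mul, mul_left_comm] }
  have hA0 : 0 ≤ A := (norm_nonneg _).trans (hA 0)
  have hB0 : 0 ≤ B := (norm_nonneg _).trans (hB 0)
  refine ⟨M.mkContinuous (A + B) fun F => ?_, hm⟩
  obtain ⟨i1, i2⟩ := integrable_mul_and_deriv F.integrable_fn F.integrable_fn' hψ hA hB
  have e1 : ∫ x, ‖ψ x * F.fn x‖ ≤ A * ∫ x, ‖F.fn x‖ := by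
    rw [← integral_const_mul]
    refine integral_mono i1.norm (F.integrable_fn.norm.const_mul A) fun x => ?_
    simp only [norm_mul]
    exact mul_le_mul_of_nonneg_right (hA x) (norm_nonneg _)
  have e2 : ∫ x, ‖ψ x * F.fn' x + deriv ψ x * F.fn x‖ ≤
      A * (∫ x, ‖F.fn' x‖) + B * ∫ x, ‖F.fn x‖ := by
    rw [← integral_const_mul, ← integral_const_mul, ← integral_add
      (F.integrable_fn'.norm.const_mul A) (F.integrable_fn.norm.const_mul B)]
    refine integral_mono i2.norm ((F.integrable_fn'.norm.const_mul A).add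
      (F.integrable_fn.norm.const_mul B)) fun x => (norm_add_le _ _).trans ?_
    simp only [norm_mul]
    exact add_le_add (mul_le_mul_of_nonneg_right (hA x) (norm_nonneg _))
      (mul_le_mul_of_nonneg_right (hB x) (norm_nonneg _))
  have e3 : 0 ≤ B * ∫ x, ‖F.fn' x‖ := mul_nonneg hB0 (integral_nonneg fun _ => norm_nonneg _)
  change ‖m F‖ ≤ _
  rw [hn, W11.norm_eq]
  linarith

/-! ### The shifted operator -/

section Shifted

variable {k : ℝ} {g : W11} {u : ℂ}

lemma shifted_fn (x : (vlasovOperator k g).domain) :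
    (shifted (vlasovOperator k g) (Complex.I * u) x).fn =ᵐ[volume] fun v : ℝ =>
      Complex.I * (((v : ℂ) - u) * x.1.fn v - integralCLM x.1 * ((k : ℂ) ^ 2)⁻¹ * g.fn v) := by
  have e : shifted (vlasovOperator k g) (Complex.I * u) x =
      vlasovOperator k g x - (Complex.I * u) • x.1 := rfl
  rw [e]
  filter_upwards [W11.fn_sub (vlasovOperator k g x) ((Complex.I * u) • x.1),
    W11.fn_smul (Complex.I * u) x.1, vlasovOperator_fn k g x] with v h1 h2 h3
  rw [h1, Pi.sub_apply, h2, h3, Pi.smul_apply, smul_eq_mul, integralCLM_apply]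
  ring

/-- Since `v F = P + u F`, it is enough for the domain that `(v - u) F` lie in `W^{1,1}`. Points of
the range can then be built from pairs `F`, `P` alone. -/
lemma exists_domain_shifted_eq {F P : W11}
    (h : P.fn =ᵐ[volume] fun v : ℝ => ((v : ℂ) - u) * F.fn v) :
    ∃ x : (vlasovOperator k g).domain, x.1 = F ∧
      shifted (vlasovOperator k g) (Complex.I * u) x =
        Complex.I • (P - (integralCLM F * ((k : ℂ) ^ 2)⁻¹) • g) := by
  have hF : MemW11 fun v : ℝ => (v : ℂ) * F.fn v := by
    refine (P.memW11.add (F.memW11.const_smul u)).congr ?_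
    filter_upwards [h] with v hv
    simp only [Pi.add_apply, Pi.smul_apply, hv, smul_eq_mul]
    ring
  refine ⟨⟨F, hF⟩, rfl, W11.ext_fn ?_⟩
  refine (shifted_fn _).trans ?_
  filter_upwards [h, W11.fn_smul Complex.I (P - (integralCLM F * ((k : ℂ) ^ 2)⁻¹) • g),
    W11.fn_sub P ((integralCLM F * ((k : ℂ) ^ 2)⁻¹) • g),
    W11.fn_smul (integralCLM F * ((k : ℂ) ^ 2)⁻¹) g] with v h1 h2 h3 h4
  rw [h2, Pi.smul_apply, h3, Pi.sub_apply, h4, h1, Pi.smul_apply, smul_eq_mul, smul_eq_mul]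

lemma exists_shifted_eq (u : ℂ) (x : (vlasovOperator k g).domain) :
    ∃ P : W11, P.fn =ᵐ[volume] (fun v : ℝ => ((v : ℂ) - u) * x.1.fn v) ∧
      shifted (vlasovOperator k g) (Complex.I * u) x =
        Complex.I • (P - (integralCLM x.1 * ((k : ℂ) ^ 2)⁻¹) • g) := by
  have hP : MemW11 fun v : ℝ => ((v : ℂ) - u) * x.1.fn v := by
    have hx : MemW11 fun v : ℝ => (v : ℂ) * x.1.fn v := x.2
    refine (hx.add (x.1.memW11.const_smul (-u))).congr (Eventually.of_forall fun v => ?_)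
    simp only [Pi.add_apply, Pi.smul_apply, smul_eq_mul]
    ring
  obtain ⟨y, hy, h⟩ := exists_domain_shifted_eq (k := k) (g := g) hP.fn_toW11
  obtain rfl : y = x := Subtype.ext hy
  exact ⟨hP.toW11, hP.fn_toW11, h⟩

end Shifted

/-! ### The resolvent off the imaginary axis -/

lemma ofReal_sub_ne_zero {u : ℂ} (hu : u.im ≠ 0) (v : ℝ) : (v : ℂ) - u ≠ 0 := by
  intro h
  apply hu
  have := congrArg Complex.im h
  simpa using this

lemma contDiff_inv_sub {u : ℂ} (hu : u.im ≠ 0) :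
    ContDiff ℝ ∞ fun v : ℝ => ((v : ℂ) - u)⁻¹ :=
  (Complex.ofRealCLM.contDiff.sub contDiff_const).inv (ofReal_sub_ne_zero hu)

lemma norm_inv_sub_le {u : ℂ} (hu : u.im ≠ 0) (v : ℝ) : ‖((v : ℂ) - u)⁻¹‖ ≤ |u.im|⁻¹ := by
  rw [norm_inv]
  refine inv_anti₀ (abs_pos.2 hu) ?_
  simpa using Complex.abs_im_le_norm ((v : ℂ) - u)

lemma norm_deriv_inv_sub_le {u : ℂ} (hu : u.im ≠ 0) (v : ℝ) :
    ‖deriv (fun v : ℝ => ((v : ℂ) - u)⁻¹) v‖ ≤ |u.im|⁻¹ ^ 2 := by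
  have h : HasDerivAt (fun v : ℝ => (v : ℂ) - u) 1 v :=
    (Complex.ofRealCLM.hasDerivAt.sub_const u).congr_deriv (by simp)
  rw [(h.fun_inv (ofReal_sub_ne_zero hu v)).deriv, norm_div, norm_neg, norm_one, norm_pow, one_div,
    ← inv_pow, ← norm_inv]
  exact pow_le_pow_left₀ (norm_nonneg _) (norm_inv_sub_le hu v) 2

lemma exists_inv_sub_clm {u : ℂ} (hu : u.im ≠ 0) :
    ∃ M : W11 →L[ℂ] W11, ∀ F, (M F).fn =ᵐ[volume] fun v : ℝ => ((v : ℂ) - u)⁻¹ * F.fn v :=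
  exists_smoothMul_clm (contDiff_inv_sub hu) (norm_inv_sub_le hu) (norm_deriv_inv_sub_le hu)

/-- Multiplication by `(v - u)⁻¹` is bounded for nonreal `u`, and a rank-one perturbation of an
invertible operator is invertible when the scalar `d` is nonzero. -/
lemma notMem_spectrum {k : ℝ} {g : W11} {u : ℂ} (hu : u.im ≠ 0)
    (hd : 1 - ((k : ℂ) ^ 2)⁻¹ * ∫ v : ℝ, ((v : ℂ) - u)⁻¹ * g.fn v ≠ 0) :
    Complex.I * u ∉ spectrum (vlasovOperator k g) := by
  obtain ⟨M, hM⟩ := exists_inv_sub_clm hu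
  have hMl : ∀ F : W11, F.fn =ᵐ[volume] fun v : ℝ => ((v : ℂ) - u) * (M F).fn v := fun F => by
    filter_upwards [hM F] with v hv
    rw [hv, mul_inv_cancel_left₀ (ofReal_sub_ne_zero hu v)]
  have hMr : ∀ {F P : W11}, P.fn =ᵐ[volume] (fun v : ℝ => ((v : ℂ) - u) * F.fn v) → M P = F :=
    fun {F P} h => W11.ext_fn <| by
      filter_upwards [hM P, h] with v h1 h2
      rw [h1, h2, inv_mul_cancel_left₀ (ofReal_sub_ne_zero hu v)]
  rw [← integral_congr_ae (hM g), ← integralCLM_apply] at hd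
  set κ : ℂ := ((k : ℂ) ^ 2)⁻¹
  set d : ℂ := 1 - κ * integralCLM (M g) with hd_def
  have hκ : κ * integralCLM (M g) = 1 - d := by rw [hd_def]; ring
  -- Solving `(v - u) F - κ J g = -i y` with `J = ∫ F` gives `F = -i M y + κ J M g`; integrating
  -- yields `d J = -i ∫ M y`, which determines `J`.
  let R : W11 →L[ℂ] W11 := (-Complex.I) • (M + ((κ / d) • integralCLM ∘L M).smulRight (M g))
  have hR : ∀ y, R y = (-Complex.I) • (M y + (κ / d * integralCLM (M y)) • M g) := fun y => rfl
  simp only [spectrum, mem_ofPred_eq, not_not]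
  refine ⟨R, fun x => ?_, fun y => ?_⟩
  · obtain ⟨P, hP, hx⟩ := exists_shifted_eq u x
    change _ = Complex.I • (P - (integralCLM x.1 * κ) • g) at hx
    rw [hx, hR, map_smul, map_sub, map_smul, hMr hP, map_smul, map_sub, map_smul, smul_eq_mul,
      smul_eq_mul]
    have e : κ / d * (Complex.I * (integralCLM x.1 - integralCLM x.1 * κ * integralCLM (M g))) =
        Complex.I * (integralCLM x.1 * κ) := by
      rw [mul_assoc _ κ, hκ]
      field_simp
      ring
    rw [e, mul_smul Complex.I, ← smul_add, sub_add_cancel, smul_smul]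
    simp
  · have hF : (y + (κ / d * integralCLM (M y)) • g).fn =ᵐ[volume]
        fun v : ℝ => ((v : ℂ) - u) * (M (y + (κ / d * integralCLM (M y)) • g)).fn v := hMl _
    obtain ⟨x, hx, hs⟩ := exists_domain_shifted_eq (k := k) (g := g) hF
    refine ⟨(-Complex.I) • x, ?_, ?_⟩
    · rw [hR, Submodule.coe_smul, hx, map_add, map_smul]
    · rw [map_smul, hs, smul_smul, map_add, map_smul, map_add, map_smul, smul_eq_mul]
      have e : (integralCLM (M y) + κ / d * integralCLM (M y) * integralCLM (M g)) * κ =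
          κ / d * integralCLM (M y) := by
        have : (integralCLM (M y) + κ / d * integralCLM (M y) * integralCLM (M g)) * κ =
          integralCLM (M y) * κ + κ / d * integralCLM (M y) * (κ * integralCLM (M g)) := by ring
        rw [this, hκ]
        field_simp
        ring
      rw [e, add_sub_cancel_right]
      simp

/-! ### Rescaling around a real point -/

lemma hasDerivAt_comp_mul_sub {f : ℝ → ℂ} {f' : ℂ} {s u x : ℝ}
    (h : HasDerivAt f f' (s * (x - u))) :
    HasDerivAt (fun x => f (s * (x - u))) (s * f') x := by
  have h1 : HasDerivAt (fun x : ℝ => s * (x - u)) s x := by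
    simpa using ((hasDerivAt_id x).sub_const u).const_mul s
  simpa [Function.comp_def] using h.scomp x h1

lemma integral_comp_mul_sub {E : Type*} [NormedAddCommGroup E] [NormedSpace ℝ E] (f : ℝ → E)
    {s : ℝ} (hs : 0 < s) (u : ℝ) : ∫ x, f (s * (x - u)) = s⁻¹ • ∫ x, f x := by
  rw [integral_sub_right_eq_self (fun x => f (s * x)) u, Measure.integral_comp_mul_left,
    abs_of_pos (inv_pos.2 hs)]

lemma integrable_comp_mul_sub {E : Type*} [NormedAddCommGroup E] {f : ℝ → E}
    (hf : Integrable f) {s : ℝ} (hs : 0 < s) (u : ℝ) : Integrable fun x => f (s * (x - u)) :=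
  (hf.comp_mul_left' hs.ne').comp_sub_right u

/-- Rescaled test functions as elements of `W^{1,1}(ℝ)`. -/
lemma exists_rescaled {φ : ℝ → ℂ} (hφ : ContDiff ℝ ∞ φ) (hc : HasCompactSupport φ) (u : ℝ)
    {s : ℝ} (hs : 0 < s) : ∃ F : W11, F.rep = (fun x => φ (s * (x - u))) ∧
      ‖F‖ = s⁻¹ * (∫ x, ‖φ x‖) + ∫ x, ‖deriv φ x‖ := by
  have hdc : Continuous (deriv φ) := hφ.continuous_deriv (by norm_num)
  have i1 : Integrable φ := hφ.continuous.integrable_of_hasCompactSupport hc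
  have i2 : Integrable (deriv φ) := hdc.integrable_of_hasCompactSupport hc.deriv
  have i3 : Integrable fun x => (s : ℂ) * deriv φ (s * (x - u)) :=
    (integrable_comp_mul_sub i2 hs u).const_mul _
  have hw : HasWeakDeriv (fun x => φ (s * (x - u))) fun x => s * deriv φ (s * (x - u)) :=
    HasWeakDeriv.of_hasDerivAt
      (fun x => hasDerivAt_comp_mul_sub (hφ.differentiable (by simp) _).hasDerivAt)
      (integrable_comp_mul_sub i1 hs u) i3
  have hm : MemW11 fun x => φ (s * (x - u)) := ⟨integrable_comp_mul_sub i1 hs u, _, i3, hw⟩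
  refine ⟨hm.toW11, W11.rep_eq hm.fn_toW11 (hφ.continuous.comp (by fun_prop)), ?_⟩
  -- The `L¹` norm scales like `s⁻¹`, whereas that of the derivative is scale invariant.
  rw [W11.norm_eq_of_hasWeakDeriv hm.fn_toW11 hw i3,
    integral_comp_mul_sub (fun x => ‖φ x‖) hs u, smul_eq_mul]
  simp only [norm_mul, Complex.norm_real, Real.norm_of_nonneg hs.le]
  rw [integral_const_mul, integral_comp_mul_sub (fun x => ‖deriv φ x‖) hs u, smul_eq_mul,
    mul_inv_cancel_left₀ hs.ne']

/-- The substitution `t = s (x - u)` turns the dangerous term `s S'(s (x - u)) F` into an integral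
against the fixed weight `S'`. This allows bounds uniform in `s` and dominated convergence as `s →
∞`. -/
lemma exists_rescaledMul (F : W11) {S : ℝ → ℂ} (hS : ContDiff ℝ ∞ S) {A B : ℝ}
    (hA : ∀ x, ‖S x‖ ≤ A) (hB : ∀ x, ‖deriv S x‖ ≤ B) (hi : Integrable (deriv S)) (u : ℝ)
    {s : ℝ} (hs : 0 < s) :
    ∃ G : W11, G.fn =ᵐ[volume] (fun x => S (s * (x - u)) * F.fn x) ∧
      ‖G‖ ≤ (∫ x, ‖S (s * (x - u))‖ * (‖F.fn x‖ + ‖F.fn' x‖)) +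
        ∫ t, ‖deriv S t‖ * ‖F.rep (u + s⁻¹ * t)‖ := by
  have hψ : ContDiff ℝ ∞ fun x => S (s * (x - u)) :=
    hS.comp (contDiff_const.mul (contDiff_id.sub contDiff_const))
  have hd : ∀ x, deriv (fun x => S (s * (x - u))) x = s * deriv S (s * (x - u)) := fun x =>
    (hasDerivAt_comp_mul_sub (hS.differentiable (by simp) _).hasDerivAt).deriv
  have hdc : Continuous (deriv S) := hS.continuous_deriv (by norm_num)
  obtain ⟨G, h1, h2⟩ := exists_smoothMul F hψ (A := A) (B := s * B) (fun x => hA _) fun x => by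
    rw [hd, norm_mul, Complex.norm_real, Real.norm_of_nonneg hs.le]
    exact mul_le_mul_of_nonneg_left (hB _) hs.le
  refine ⟨G, h1, h2.trans_le ?_⟩
  have j1 : Integrable fun x => S (s * (x - u)) * F.fn x :=
    F.integrable_fn.bdd_mul hψ.continuous.aestronglyMeasurable (Eventually.of_forall fun x => hA _)
  have j2 : Integrable fun x => S (s * (x - u)) * F.fn' x :=
    F.integrable_fn'.bdd_mul hψ.continuous.aestronglyMeasurable
      (Eventually.of_forall fun x => hA _)
  have j4 : Integrable fun t => ‖deriv S t‖ * ‖F.rep (u + s⁻¹ * t)‖ :=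
    hi.norm.mul_bdd ((F.continuous_rep.comp (by fun_prop)).norm.aestronglyMeasurable)
      (Eventually.of_forall fun x => by
        rw [norm_norm]
        exact F.norm_rep_le _)
  have ec : ∀ x, u + s⁻¹ * (s * (x - u)) = x := fun x => by field_simp; ring
  have j5 : Integrable fun x => s * (‖deriv S (s * (x - u))‖ * ‖F.rep x‖) := by
    simpa only [ec] using (integrable_comp_mul_sub j4 hs u).const_mul s
  have e1 : ∫ t, ‖deriv S t‖ * ‖F.rep (u + s⁻¹ * t)‖ =
      ∫ x, s * (‖deriv S (s * (x - u))‖ * ‖F.rep x‖) := by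
    have := integral_comp_mul_sub (fun t => ‖deriv S t‖ * ‖F.rep (u + s⁻¹ * t)‖) hs u
    simp only [ec] at this
    rw [integral_const_mul, this, smul_eq_mul, mul_inv_cancel_left₀ hs.ne']
  have e2 : (∫ x, ‖S (s * (x - u))‖ * (‖F.fn x‖ + ‖F.fn' x‖)) =
      (∫ x, ‖S (s * (x - u)) * F.fn x‖) + ∫ x, ‖S (s * (x - u)) * F.fn' x‖ := by
    rw [← integral_add j1.norm j2.norm]
    simp only [norm_mul, mul_add]
  rw [e1, e2, add_assoc, ← integral_add j2.norm j5]
  refine add_le_add le_rfl ?_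
  refine integral_mono_of_nonneg (Eventually.of_forall fun _ => norm_nonneg _)
    (j2.norm.add j5) ?_
  filter_upwards [F.fn_ae_eq_rep] with x hx
  refine (norm_add_le _ _).trans (add_le_add le_rfl ?_)
  rw [hd, norm_mul, norm_mul, Complex.norm_real, Real.norm_of_nonneg hs.le, hx, mul_assoc]

/-! ### Explicit multipliers -/

lemma one_add_sq_pos (t : ℝ) : 0 < 1 + t ^ 2 := by positivity

lemma abs_le_one_add_sq (t : ℝ) : 2 * |t| ≤ 1 + t ^ 2 := by
  nlinarith [sq_nonneg (|t| - 1), sq_abs t]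

/-- The Cauchy profile `1 / (1 + t²)`. -/
def cauchy (t : ℝ) : ℝ := (1 + t ^ 2)⁻¹

/-- The conjugate Cauchy profile `t / (1 + t²)`. -/
def conjCauchy (t : ℝ) : ℝ := t * (1 + t ^ 2)⁻¹

/-- The profile `1 / √(1 + t²)`. -/
def invBracket (t : ℝ) : ℝ := (√(1 + t ^ 2))⁻¹

/-- The smoothed sign function `t / √(1 + t²)`. -/
def smoothSign (t : ℝ) : ℝ := t * (√(1 + t ^ 2))⁻¹

/-- The profiles are used in pairs: `1 - cauchy t = t * conjCauchy t` and `smoothSign t = t *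
invBracket t`. After rescaling, each left side is `v - u` times a bounded smooth multiplier. -/
lemma contDiff_cauchy : ContDiff ℝ ∞ cauchy :=
  (contDiff_const.add (contDiff_id.pow 2)).inv fun t => (one_add_sq_pos t).ne'

lemma contDiff_conjCauchy : ContDiff ℝ ∞ conjCauchy := contDiff_id.mul contDiff_cauchy

lemma contDiff_invBracket : ContDiff ℝ ∞ invBracket :=
  ((contDiff_const.add (contDiff_id.pow 2)).sqrt fun t => (one_add_sq_pos t).ne').inv
    fun t => (Real.sqrt_pos.2 (one_add_sq_pos t)).ne'

lemma contDiff_smoothSign : ContDiff ℝ ∞ smoothSign := contDiff_id.mul contDiff_invBracket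

lemma cauchy_pos (t : ℝ) : 0 < cauchy t := inv_pos.2 (one_add_sq_pos t)

lemma cauchy_le_one (t : ℝ) : cauchy t ≤ 1 := inv_le_one_of_one_le₀ (by nlinarith [sq_nonneg t])

lemma hasDerivAt_one_add_sq (t : ℝ) : HasDerivAt (fun t : ℝ => 1 + t ^ 2) (2 * t) t := by
  simpa using (hasDerivAt_pow 2 t).const_add 1

lemma hasDerivAt_cauchy (t : ℝ) : HasDerivAt cauchy (-(2 * t) / (1 + t ^ 2) ^ 2) t :=
  (hasDerivAt_one_add_sq t).fun_inv (one_add_sq_pos t).ne'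

lemma hasDerivAt_conjCauchy (t : ℝ) :
    HasDerivAt conjCauchy ((1 - t ^ 2) / (1 + t ^ 2) ^ 2) t := by
  refine ((hasDerivAt_id t).mul (hasDerivAt_cauchy t)).congr_deriv ?_
  have := (one_add_sq_pos t).ne'
  simp only [cauchy, id]
  field_simp
  ring

lemma hasDerivAt_invBracket (t : ℝ) :
    HasDerivAt invBracket (-(t * (cauchy t * invBracket t))) t := by
  have h0 := one_add_sq_pos t
  refine (((hasDerivAt_one_add_sq t).sqrt h0.ne').fun_inv (Real.sqrt_pos.2 h0).ne').congr_deriv ?_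
  rw [Real.sq_sqrt h0.le, cauchy, invBracket]
  have := (Real.sqrt_pos.2 h0).ne'
  field_simp

lemma hasDerivAt_smoothSign (t : ℝ) : HasDerivAt smoothSign (cauchy t * invBracket t) t := by
  refine ((hasDerivAt_id t).mul (hasDerivAt_invBracket t)).congr_deriv ?_
  have h : (1 + t ^ 2) * cauchy t = 1 := mul_inv_cancel₀ (one_add_sq_pos t).ne'
  simp only [id]
  linear_combination (-invBracket t) * h

lemma abs_deriv_cauchy_le (t : ℝ) : |deriv cauchy t| ≤ cauchy t := by
  have h0 := one_add_sq_pos t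
  rw [(hasDerivAt_cauchy t).deriv, abs_div, abs_neg, abs_mul, abs_two, abs_of_pos (pow_pos h0 2),
    cauchy, div_le_iff₀ (pow_pos h0 2), pow_two (1 + t ^ 2), inv_mul_cancel_left₀ h0.ne']
  exact abs_le_one_add_sq t

lemma abs_conjCauchy_le_one (t : ℝ) : |conjCauchy t| ≤ 1 := by
  have h0 := one_add_sq_pos t
  rw [conjCauchy, ← div_eq_mul_inv, abs_div, abs_of_pos h0, div_le_one h0]
  linarith [abs_le_one_add_sq t, abs_nonneg t]

lemma abs_deriv_conjCauchy_le (t : ℝ) : |deriv conjCauchy t| ≤ cauchy t := by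
  have h0 := one_add_sq_pos t
  rw [(hasDerivAt_conjCauchy t).deriv, abs_div, abs_of_pos (pow_pos h0 2),
    cauchy, div_le_iff₀ (pow_pos h0 2), pow_two (1 + t ^ 2), inv_mul_cancel_left₀ h0.ne', abs_le]
  constructor <;> nlinarith [sq_nonneg t]

lemma invBracket_pos (t : ℝ) : 0 < invBracket t := inv_pos.2 (Real.sqrt_pos.2 (one_add_sq_pos t))

lemma invBracket_le_one (t : ℝ) : invBracket t ≤ 1 :=
  inv_le_one_of_one_le₀ (Real.one_le_sqrt.2 (by nlinarith [sq_nonneg t]))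

lemma abs_smoothSign_le_one (t : ℝ) : |smoothSign t| ≤ 1 := by
  have h0 := Real.sqrt_pos.2 (one_add_sq_pos t)
  rw [smoothSign, ← div_eq_mul_inv, abs_div, abs_of_pos h0, div_le_one h0]
  exact Real.abs_le_sqrt (by linarith)

lemma abs_deriv_smoothSign_le (t : ℝ) : |deriv smoothSign t| ≤ cauchy t := by
  rw [(hasDerivAt_smoothSign t).deriv,
    abs_of_pos (mul_pos (cauchy_pos t) (invBracket_pos t))]
  exact mul_le_of_le_one_right (cauchy_pos t).le (invBracket_le_one t)

lemma abs_deriv_invBracket_le_one (t : ℝ) : |deriv invBracket t| ≤ 1 := by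
  have h : -(t * (cauchy t * invBracket t)) = -(conjCauchy t * invBracket t) := by
    rw [conjCauchy, cauchy]; ring
  rw [(hasDerivAt_invBracket t).deriv, h, abs_neg, abs_mul, abs_of_pos (invBracket_pos t)]
  exact mul_le_one₀ (abs_conjCauchy_le_one t) (invBracket_pos t).le (invBracket_le_one t)

lemma contDiff_ofReal_comp {ρ : ℝ → ℝ} (h : ContDiff ℝ ∞ ρ) :
    ContDiff ℝ ∞ fun t => (ρ t : ℂ) := Complex.ofRealCLM.contDiff.comp h

lemma deriv_ofReal_comp {ρ : ℝ → ℝ} (h : ContDiff ℝ ∞ ρ) (t : ℝ) :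
    deriv (fun t => (ρ t : ℂ)) t = ((deriv ρ t : ℝ) : ℂ) :=
  ((h.differentiable (by simp) t).hasDerivAt.ofReal_comp).deriv

/-- Rescaled real multipliers with a derivative dominated by the Cauchy profile. -/
lemma exists_rescaledMul_real (F : W11) {S : ℝ → ℝ} (hS : ContDiff ℝ ∞ S)
    (hA : ∀ x, |S x| ≤ 1) (hB : ∀ x, |deriv S x| ≤ cauchy x) (u : ℝ) {s : ℝ} (hs : 0 < s) :
    ∃ G : W11, G.fn =ᵐ[volume] (fun x => (S (s * (x - u)) : ℂ) * F.fn x) ∧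
      ‖G‖ ≤ (∫ x, |S (s * (x - u))| * (‖F.fn x‖ + ‖F.fn' x‖)) +
        ∫ t, |deriv S t| * ‖F.rep (u + s⁻¹ * t)‖ := by
  have hc := contDiff_ofReal_comp hS
  have hn : ∀ t, ‖deriv (fun t => (S t : ℂ)) t‖ = |deriv S t| := fun t => by
    rw [deriv_ofReal_comp hS, Complex.norm_real, Real.norm_eq_abs]
  have hi : Integrable (deriv fun t => (S t : ℂ)) :=
    integrable_inv_one_add_sq.mono' (hc.continuous_deriv (by norm_num)).aestronglyMeasurable
      (Eventually.of_forall fun t => (hn t).trans_le (hB t))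
  obtain ⟨G, h1, h2⟩ := exists_rescaledMul F hc (A := 1) (B := 1)
    (fun x => by simpa using hA x) (fun x => (hn x).trans_le ((hB x).trans (cauchy_le_one x)))
    hi u hs
  simp only [hn, Complex.norm_real, Real.norm_eq_abs] at h2
  exact ⟨G, h1, h2⟩

/-- Multiplication by a rescaled real multiplier with bounded derivative. -/
lemma exists_mul_of_bounded (F : W11) {ρ : ℝ → ℝ} (hρ : ContDiff ℝ ∞ ρ)
    (hA : ∀ x, |ρ x| ≤ 1) (hB : ∀ x, |deriv ρ x| ≤ 1) (u : ℝ) {s : ℝ} (hs : 0 < s) :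
    ∃ G : W11, G.fn =ᵐ[volume] fun x => ((s * ρ (s * (x - u)) : ℝ) : ℂ) * F.fn x := by
  have hψ : ContDiff ℝ ∞ fun x => s * ρ (s * (x - u)) :=
    contDiff_const.mul (hρ.comp (contDiff_const.mul (contDiff_id.sub contDiff_const)))
  have hd : ∀ x, deriv (fun x => s * ρ (s * (x - u))) x = s * (deriv ρ (s * (x - u)) * s) := by
    intro x
    have h1 : HasDerivAt (fun x : ℝ => s * (x - u)) s x := by
      simpa using ((hasDerivAt_id x).sub_const u).const_mul s
    exact (((hρ.differentiable (by simp) _).hasDerivAt.comp x h1).const_mul s).deriv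
  obtain ⟨G, hG, -⟩ := exists_smoothMul F (contDiff_ofReal_comp hψ) (A := s) (B := s * s)
    (fun x => by
      rw [Complex.norm_real, Real.norm_eq_abs, abs_mul, abs_of_pos hs]
      exact mul_le_of_le_one_right hs.le (hA _))
    (fun x => by
      rw [deriv_ofReal_comp hψ, hd, Complex.norm_real, Real.norm_eq_abs, abs_mul, abs_mul,
        abs_of_pos hs]
      exact mul_le_mul_of_nonneg_left (mul_le_of_le_one_left hs.le (hB _)) hs.le)
  exact ⟨G, hG⟩

/-! ### The range and the inverse at real points -/

/-- A smooth bump equal to one on the unit ball. -/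
def unitBump : ContDiffBump (0 : ℝ) := ⟨1, 2, one_pos, one_lt_two⟩

lemma unitBump_eq_one {x : ℝ} (hx : |x| ≤ 1) : unitBump x = 1 :=
  unitBump.one_of_mem_closedBall (by simpa [unitBump] using hx)

lemma hasCompactSupport_ofReal_comp {ρ : ℝ → ℝ} (h : HasCompactSupport ρ) :
    HasCompactSupport fun t => (ρ t : ℂ) := h.comp_left (g := Complex.ofReal) rfl

lemma exists_unitBump (u : ℝ) : ∃ F : W11, F.rep = fun x => (unitBump (x - u) : ℂ) := by
  obtain ⟨F, hF, -⟩ := exists_rescaled (contDiff_ofReal_comp unitBump.contDiff)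
    (hasCompactSupport_ofReal_comp unitBump.hasCompactSupport) u one_pos
  exact ⟨F, by simpa only [one_mul] using hF⟩

/-- Both sides have continuous representatives, so the a.e. identity holds at the single point `u`.
-/
lemma rep_eq_zero_of_fn_eq {F P : W11} {u : ℝ}
    (h : P.fn =ᵐ[volume] fun v : ℝ => ((v : ℂ) - u) * F.fn v) : P.rep u = 0 := by
  have h' : P.rep = fun v : ℝ => ((v : ℂ) - u) * F.rep v := by
    refine W11.rep_eq ?_ (by have := F.continuous_rep; fun_prop)
    filter_upwards [h, F.fn_ae_eq_rep] with v h1 h2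
    rw [h1, h2]
  simp [h']

/-- Every element of the range vanishes at `u`, so a function equal to `1` there is at distance at
least `1` from the range. -/
lemma not_dense_range_shifted {k : ℝ} {g : W11} {u : ℝ} (hg : g.rep u = 0) :
    ¬ Dense (range (shifted (vlasovOperator k g) (Complex.I * u))) := by
  intro hd
  obtain ⟨y, hy⟩ := exists_unitBump u
  obtain ⟨_, ⟨x, rfl⟩, hx⟩ := hd.exists_dist_lt y one_pos
  obtain ⟨P, hP, hs⟩ := exists_shifted_eq (u : ℂ) x
  have h0 : (shifted (vlasovOperator k g) (Complex.I * u) x).rep u = 0 := by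
    rw [hs, W11.rep_smul, W11.rep_sub, W11.rep_smul]
    simp [rep_eq_zero_of_fn_eq hP, hg]
  have h1 := W11.norm_rep_le (y - shifted (vlasovOperator k g) (Complex.I * u) x) u
  rw [W11.rep_sub, Pi.sub_apply, h0, hy, sub_zero] at h1
  beta_reduce at h1
  rw [sub_self, unitBump_eq_one (by simp)] at h1
  rw [dist_eq_norm] at hx
  simp only [Complex.ofReal_one, norm_one] at h1
  linarith

/-- The functions `φ'(s (v - u))` take the value `1` at `u`, so their norms are at least `1`.
Multiplying by `v - u` gains a factor `s⁻¹`, and their zero mean removes the rank-one term. -/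
lemma not_exists_bound_shifted (k : ℝ) (g : W11) (u : ℝ) :
    ¬ ∃ C : ℝ, ∀ x : (vlasovOperator k g).domain,
      ‖(x : W11)‖ ≤ C * ‖shifted (vlasovOperator k g) (Complex.I * u) x‖ := by
  rintro ⟨C, hC⟩
  -- Equal to `t` near `0` and compactly supported, so that `φ'` has value `1` at `0` and integral
  -- `0`.
  let φ : ℝ → ℂ := fun t => (t * unitBump t : ℝ)
  have hφ : ContDiff ℝ ∞ φ := contDiff_ofReal_comp (contDiff_id.mul unitBump.contDiff)
  have hφc : HasCompactSupport φ :=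
    hasCompactSupport_ofReal_comp unitBump.hasCompactSupport.mul_left
  have hψ : ContDiff ℝ ∞ (deriv φ) := (contDiff_infty_iff_deriv.1 hφ).2
  have hψc : HasCompactSupport (deriv φ) := hφc.deriv
  have hψ0 : deriv φ 0 = 1 := by
    have h1 : φ =ᶠ[𝓝 0] fun t : ℝ => (t : ℂ) := by
      filter_upwards [Metric.closedBall_mem_nhds (0 : ℝ) one_pos] with t ht
      simp only [φ]
      rw [unitBump_eq_one (by simpa using ht), mul_one]
    rw [h1.deriv_eq]
    exact Complex.ofRealCLM.hasDerivAt.deriv.trans (by simp)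
  have hψi : ∫ t, deriv φ t = 0 :=
    integral_eq_zero_of_hasDerivAt_of_integrable
      (fun t => (hφ.differentiable (by simp) t).hasDerivAt)
      (hψ.continuous.integrable_of_hasCompactSupport hψc)
      (hφ.continuous.integrable_of_hasCompactSupport hφc)
  let η : ℝ → ℂ := fun t => (t : ℂ) * deriv φ t
  have hη : ContDiff ℝ ∞ η := Complex.ofRealCLM.contDiff.mul hψ
  have hηc : HasCompactSupport η := hψc.mul_left
  set K : ℝ := (∫ x, ‖η x‖) + ∫ x, ‖deriv η x‖
  have hη0 : 0 ≤ ∫ x, ‖η x‖ := integral_nonneg fun _ => norm_nonneg _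
  have hη1 : 0 ≤ ∫ x, ‖deriv η x‖ := integral_nonneg fun _ => norm_nonneg _
  obtain ⟨n, hn⟩ := exists_nat_gt (|C| * K)
  set s : ℝ := n + 1
  have hs1 : (1 : ℝ) ≤ s := by simp [s]
  have hs : 0 < s := one_pos.trans_le hs1
  obtain ⟨F, hF, -⟩ := exists_rescaled hψ hψc u hs
  obtain ⟨Q, hQ, hQn⟩ := exists_rescaled hη hηc u hs
  have hP : ((s : ℂ)⁻¹ • Q).fn =ᵐ[volume] fun v : ℝ => ((v : ℂ) - u) * F.fn v := by
    filter_upwards [W11.fn_smul ((s : ℂ)⁻¹) Q, Q.fn_ae_eq_rep, F.fn_ae_eq_rep] with v h1 h2 h3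
    have hsc : (s : ℂ) ≠ 0 := Complex.ofReal_ne_zero.2 hs.ne'
    rw [h1, Pi.smul_apply, h2, h3, hQ, hF, smul_eq_mul]
    simp only [η]
    push_cast
    field_simp
  obtain ⟨x, hx, hsx⟩ := exists_domain_shifted_eq (k := k) (g := g) hP
  have hF0 : integralCLM F = 0 := by
    rw [integralCLM_apply, integral_congr_ae F.fn_ae_eq_rep, hF,
      integral_comp_mul_sub _ hs, hψi, smul_zero]
  have h1 : ‖shifted (vlasovOperator k g) (Complex.I * u) x‖ ≤ s⁻¹ * K := by
    rw [hsx, hF0, zero_mul, zero_smul, sub_zero, norm_smul, norm_smul, hQn, Complex.norm_I,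
      one_mul, norm_inv, Complex.norm_real, Real.norm_of_nonneg hs.le]
    refine mul_le_mul_of_nonneg_left (add_le_add ?_ le_rfl) (inv_nonneg.2 hs.le)
    exact mul_le_of_le_one_left hη0 (inv_le_one_of_one_le₀ hs1)
  have h2 : 1 ≤ ‖(x : W11)‖ := by
    have := F.norm_rep_le u
    rw [hF] at this
    beta_reduce at this
    rwa [sub_self, mul_zero, hψ0, norm_one, ← hx] at this
  have h3 : 1 ≤ |C| * (s⁻¹ * K) :=
    h2.trans ((hC x).trans (mul_le_mul (le_abs_self C) h1 (norm_nonneg _) (abs_nonneg C)))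
  have h4 : s ≤ |C| * K := by
    have := mul_le_mul_of_nonneg_left h3 hs.le
    have e : s * (|C| * (s⁻¹ * K)) = |C| * K := by field_simp
    linarith
  have : (n : ℝ) ≤ s := by simp [s]
  linarith

/-- Elements vanishing at `u` are limits of elements divisible by `v - u`. -/
lemma exists_divisible_near {y : W11} {u : ℝ} (hy : y.rep u = 0) {ε : ℝ} (hε : 0 < ε) :
    ∃ F P : W11, P.fn =ᵐ[volume] (fun v : ℝ => ((v : ℂ) - u) * F.fn v) ∧ ‖y - P‖ < ε := by
  have hs : ∀ n : ℕ, (0 : ℝ) < n + 1 := fun n => by positivity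
  have hA : ∀ t, |cauchy t| ≤ 1 := fun t => by
    rw [abs_of_pos (cauchy_pos t)]
    exact cauchy_le_one t
  choose G hG hGn using fun n : ℕ =>
    exists_rescaledMul_real y contDiff_cauchy hA abs_deriv_cauchy_le u (hs n)
  have hinv : Tendsto (fun n : ℕ => ((n : ℝ) + 1)⁻¹) atTop (𝓝 0) := by
    simpa using tendsto_one_div_add_atTop_nhds_zero_nat (𝕜 := ℝ)
  have hcont : Continuous cauchy := contDiff_cauchy.continuous
  have t1 : Tendsto (fun n : ℕ => ∫ x, |cauchy ((n + 1) * (x - u))| * (‖y.fn x‖ + ‖y.fn' x‖))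
      atTop (𝓝 (∫ _ : ℝ, (0 : ℝ))) := by
    refine tendsto_integral_of_dominated_convergence (fun x => ‖y.fn x‖ + ‖y.fn' x‖)
      (fun n => ?_) (y.integrable_fn.norm.add y.integrable_fn'.norm)
      (fun n => Eventually.of_forall fun x => ?_) ?_
    · exact (Continuous.aestronglyMeasurable (by fun_prop)).mul
        (y.integrable_fn.norm.add y.integrable_fn'.norm).aestronglyMeasurable
    · rw [Real.norm_of_nonneg (by positivity)]
      exact mul_le_of_le_one_left (by positivity) (hA _)
    · filter_upwards [Measure.ae_ne volume u] with x hx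
      have hx' : 0 < (x - u) ^ 2 := by
        have := sub_ne_zero.2 hx
        positivity
      have h1 : Tendsto (fun n : ℕ => |cauchy ((n + 1) * (x - u))|) atTop (𝓝 0) := by
        refine squeeze_zero (fun n => abs_nonneg _) (fun n => ?_)
          (by simpa using hinv.mul_const ((x - u) ^ 2)⁻¹)
        rw [abs_of_pos (cauchy_pos _), cauchy, ← mul_inv]
        refine inv_anti₀ (mul_pos (hs n) hx') ?_
        have : (1 : ℝ) ≤ n + 1 := by simp
        nlinarith [mul_nonneg (sub_nonneg.2 this) (mul_pos (hs n) hx').le]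
      simpa using h1.mul_const (‖y.fn x‖ + ‖y.fn' x‖)
  have t2 : Tendsto (fun n : ℕ => ∫ t, |deriv cauchy t| * ‖y.rep (u + ((n : ℝ) + 1)⁻¹ * t)‖)
      atTop (𝓝 (∫ _ : ℝ, (0 : ℝ))) := by
    have hd : Continuous (deriv cauchy) := contDiff_cauchy.continuous_deriv (by norm_num)
    have hyc := y.continuous_rep
    refine tendsto_integral_of_dominated_convergence (fun t => cauchy t * ‖y‖)
      (fun n => Continuous.aestronglyMeasurable (by fun_prop))
      (integrable_inv_one_add_sq.mul_const _) (fun n => Eventually.of_forall fun t => ?_)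
      (Eventually.of_forall fun t => ?_)
    · rw [Real.norm_of_nonneg (by positivity)]
      exact mul_le_mul (abs_deriv_cauchy_le t) (y.norm_rep_le _) (norm_nonneg _) (cauchy_pos t).le
    -- The vanishing of `y` at `u` enters here: the derivative of the rescaled cutoff keeps its `L¹`
    -- mass, but in the limit it only sees the value at `u`.
    · have h1 : Tendsto (fun n : ℕ => u + ((n : ℝ) + 1)⁻¹ * t) atTop (𝓝 (u + 0 * t)) :=
        (hinv.mul_const t).const_add u
      have h2 := (((hyc.tendsto _).comp h1).norm).const_mul |deriv cauchy t|
      simpa [hy] using h2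
  have t3 := t1.add t2
  simp only [integral_zero, add_zero] at t3
  obtain ⟨n, hn⟩ := (t3.eventually_lt_const hε).exists
  -- Removing the part of `y` concentrated at `u` leaves `(1 - cauchy) y`, which is divisible by `v
  -- - u` with this quotient.
  obtain ⟨F, hF⟩ := exists_mul_of_bounded y contDiff_conjCauchy abs_conjCauchy_le_one
    (fun t => (abs_deriv_conjCauchy_le t).trans (cauchy_le_one t)) u (hs n)
  refine ⟨F, y - G n, ?_, by rw [sub_sub_cancel]; exact (hGn n).trans_lt hn⟩
  filter_upwards [hF, hG n, W11.fn_sub y (G n)] with v h1 h2 h3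
  rw [h3, Pi.sub_apply, h1, h2]
  have e : 1 - cauchy ((n + 1) * (v - u)) =
      (v - u) * ((n + 1) * conjCauchy ((n + 1) * (v - u))) := by
    have := (one_add_sq_pos (((n : ℝ) + 1) * (v - u))).ne'
    rw [cauchy, conjCauchy]
    field_simp
    ring
  have e' := congrArg Complex.ofReal e
  push_cast at e' ⊢
  linear_combination (y.fn v) * e'

/-- The integral is unbounded on functions `f` with respect to the norm of `(v - u) f`. -/
lemma exists_integral_eq_one_near (u : ℝ) {ε : ℝ} (hε : 0 < ε) :
    ∃ F P : W11, P.fn =ᵐ[volume] (fun v : ℝ => ((v : ℂ) - u) * F.fn v) ∧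
      integralCLM F = 1 ∧ ‖P‖ < ε := by
  obtain ⟨m, hm⟩ := exists_unitBump u
  set K : ℝ := (∫ x, (‖m.fn x‖ + ‖m.fn' x‖)) + ∫ t, cauchy t * ‖m‖
  have him := m.integrable_fn.norm.add m.integrable_fn'.norm
  -- The smoothed sign is bounded by `1` and its rescaled derivative has an `L¹` norm independent of
  -- `s`, so one `K` serves all `s`.
  have hP : ∀ s : ℝ, 0 < s → ∃ P : W11,
      P.fn =ᵐ[volume] (fun x => (smoothSign (s * (x - u)) : ℂ) * m.fn x) ∧ ‖P‖ ≤ K := by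
    intro s hs
    obtain ⟨P, h1, h2⟩ := exists_rescaledMul_real m contDiff_smoothSign abs_smoothSign_le_one
      abs_deriv_smoothSign_le u hs
    refine ⟨P, h1, h2.trans (add_le_add ?_ ?_)⟩
    · refine integral_mono_of_nonneg (Eventually.of_forall fun _ => by positivity) him
        (Eventually.of_forall fun x => mul_le_of_le_one_left (by positivity) ?_)
      exact abs_smoothSign_le_one _
    · refine integral_mono_of_nonneg (Eventually.of_forall fun _ => by positivity)
        (integrable_inv_one_add_sq.mul_const _) (Eventually.of_forall fun t => ?_)
      exact mul_le_mul (abs_deriv_smoothSign_le t) (m.norm_rep_le _) (norm_nonneg _)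
        (cauchy_pos t).le
  -- The integral of the quotient will be at least `log s / 2`; this choice makes it exceed `K / ε`,
  -- so normalising it to `1` brings the norm of `P` below `ε`.
  obtain ⟨s, hs1, hsK⟩ : ∃ s : ℝ, 1 < s ∧ 2 * (K / ε) < Real.log s :=
    ((eventually_gt_atTop 1).and (Real.tendsto_log_atTop.eventually_gt_atTop _)).exists
  have hs : 0 < s := one_pos.trans hs1
  obtain ⟨P, hP1, hP2⟩ := hP s hs
  have hinvA : ∀ t, |invBracket t| ≤ 1 := fun t => by
    rw [abs_of_pos (invBracket_pos t)]
    exact invBracket_le_one t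
  obtain ⟨F, hF⟩ := exists_mul_of_bounded m contDiff_invBracket hinvA
    abs_deriv_invBracket_le_one u hs
  have hPF : P.fn =ᵐ[volume] fun v : ℝ => ((v : ℂ) - u) * F.fn v := by
    filter_upwards [hP1, hF] with v h1 h2
    rw [h1, h2]
    simp only [smoothSign, invBracket]
    push_cast
    ring
  set w : ℝ → ℝ := fun x => s * invBracket (s * (x - u)) * unitBump (x - u)
  have hFw : F.fn =ᵐ[volume] fun x => (w x : ℂ) := by
    filter_upwards [hF, m.fn_ae_eq_rep] with v h1 h2
    rw [h1, h2, hm, ← Complex.ofReal_mul]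
  have hw0 : ∀ x, 0 ≤ w x := fun x =>
    mul_nonneg (mul_nonneg hs.le (invBracket_pos _).le) unitBump.nonneg
  have hwi : Integrable w := by
    refine (F.integrable_fn.norm.congr ?_)
    filter_upwards [hFw] with x hx
    rw [hx, Complex.norm_real, Real.norm_of_nonneg (hw0 x)]
  have hF1 : integralCLM F = ((∫ x, w x : ℝ) : ℂ) := by
    rw [integralCLM_apply, integral_congr_ae hFw]
    exact integral_ofReal
  -- On `s⁻¹ < x - u ≤ 1` the bump equals `1` and, with `t = x - u`, `√(1 + (s t)²) ≤ 2 s t`; hence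
  -- `w ≥ 1 / (2 t)` there.
  have hlow : Real.log s / 2 ≤ ∫ x, w x := by
    have hle : s⁻¹ ≤ 1 := inv_le_one_of_one_le₀ hs1.le
    have hsi : 0 < s⁻¹ := inv_pos.2 hs
    have e : ∫ t in s⁻¹..1, t⁻¹ / 2 = Real.log s / 2 := by
      rw [intervalIntegral.integral_div, integral_inv_of_pos hsi one_pos, one_div, inv_inv]
    have hwu : Integrable fun t => w (t + u) := hwi.comp_add_right u
    rw [← e, ← integral_add_right_eq_self w u]
    refine le_trans ?_ (setIntegral_le_integral (s := Ioc s⁻¹ 1) hwu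
      (Eventually.of_forall fun t => hw0 _))
    rw [intervalIntegral.integral_of_le hle]
    refine setIntegral_mono_on ?_ hwu.integrableOn measurableSet_Ioc fun t ht => ?_
    · refine (intervalIntegrable_iff_integrableOn_Ioc_of_le hle).1
        (ContinuousOn.intervalIntegrable ?_)
      rw [uIcc_of_le hle]
      exact (continuousOn_inv₀.mono fun t ht => (hsi.trans_le ht.1).ne').div_const 2
    · have ht0 : 0 < t := hsi.trans ht.1
      have hst : 1 ≤ s * t := by
        have := mul_le_mul_of_nonneg_left ht.1.le hs.le
        rwa [mul_inv_cancel₀ hs.ne'] at this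
      simp only [w, add_sub_cancel_right]
      rw [unitBump_eq_one (by rw [abs_of_pos ht0]; exact ht.2), mul_one, invBracket]
      have h1 : √(1 + (s * t) ^ 2) ≤ 2 * (s * t) :=
        Real.sqrt_le_iff.2 ⟨by positivity, by nlinarith⟩
      have h2 : t⁻¹ / 2 = s * (2 * (s * t))⁻¹ := by field_simp
      rw [h2]
      exact mul_le_mul_of_nonneg_left
        (inv_anti₀ (Real.sqrt_pos.2 (one_add_sq_pos _)) h1) hs.le
  have hK : 0 ≤ K := (norm_nonneg _).trans hP2
  have hpos : 0 < ∫ x, w x := by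
    have : 0 ≤ K / ε := div_nonneg hK hε.le
    linarith
  set c : ℂ := ((∫ x, w x : ℝ) : ℂ)⁻¹
  refine ⟨c • F, c • P, ?_, ?_, ?_⟩
  · filter_upwards [hPF, W11.fn_smul c F, W11.fn_smul c P] with v h1 h2 h3
    rw [h3, h2, Pi.smul_apply, Pi.smul_apply, h1, smul_eq_mul, smul_eq_mul, mul_left_comm]
  · rw [map_smul, hF1, smul_eq_mul, inv_mul_cancel₀ (Complex.ofReal_ne_zero.2 hpos.ne')]
  · rw [norm_smul, norm_inv, Complex.norm_real, Real.norm_of_nonneg hpos.le,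
      inv_mul_lt_iff₀ hpos]
    have h1 : K / ε < ∫ x, w x := by linarith
    have h2 := (div_lt_iff₀ hε).1 h1
    linarith

/-- Subtracting `c g` makes the target vanish at `u`, so it is nearly `(v - u) F₁`. Adding a
multiple of `F₂` adjusts the integral so that the rank-one term restores `c g`, and barely changes
the multiplication term. -/
lemma dense_range_shifted {k : ℝ} (hk : 0 < k) {g : W11} {u : ℝ} (hg : g.rep u ≠ 0) :
    Dense (range (shifted (vlasovOperator k g) (Complex.I * u))) := by
  have hk' : (k : ℂ) ≠ 0 := Complex.ofReal_ne_zero.2 hk.ne'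
  rw [Metric.dense_iff]
  intro Y ε hε
  set y : W11 := (-Complex.I) • Y
  set c : ℂ := y.rep u / g.rep u
  have hz : (y - c • g).rep u = 0 := by
    rw [W11.rep_sub, W11.rep_smul c g, Pi.sub_apply, Pi.smul_apply, smul_eq_mul,
      div_mul_cancel₀ _ hg, sub_self]
  obtain ⟨F₁, P₁, h1, h1n⟩ := exists_divisible_near hz (half_pos hε)
  -- Chosen so that `F₁ + a F₂` has integral `-c k²`, since `F₂` will have integral `1`.
  set a : ℂ := -c * (k : ℂ) ^ 2 - integralCLM F₁
  obtain ⟨F₂, P₂, h2, h2i, h2n⟩ := exists_integral_eq_one_near u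
    (ε := ε / 2 / (‖a‖ + 1)) (by positivity)
  have hF : (P₁ + a • P₂).fn =ᵐ[volume] fun v : ℝ => ((v : ℂ) - u) * (F₁ + a • F₂).fn v := by
    filter_upwards [h1, h2, W11.fn_add P₁ (a • P₂), W11.fn_smul a P₂, W11.fn_add F₁ (a • F₂),
      W11.fn_smul a F₂] with v e1 e2 e3 e4 e5 e6
    rw [e3, e5, Pi.add_apply, Pi.add_apply, e4, e6, Pi.smul_apply, Pi.smul_apply, e1, e2,
      smul_eq_mul, smul_eq_mul]
    ring
  obtain ⟨x, -, hx⟩ := exists_domain_shifted_eq (k := k) (g := g) hF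
  have hi : integralCLM (F₁ + a • F₂) * ((k : ℂ) ^ 2)⁻¹ = -c := by
    rw [map_add, map_smul, h2i, smul_eq_mul, mul_one]
    simp only [a]
    field_simp
    ring
  refine ⟨_, ?_, x, rfl⟩
  have hY : Y = Complex.I • y := by
    simp only [y, smul_smul]
    simp
  have e : P₁ + a • P₂ - (-c) • g - y = a • P₂ - (y - c • g - P₁) := by
    rw [neg_smul]; abel
  rw [hx, hi, Metric.mem_ball, dist_eq_norm, hY, ← smul_sub, norm_smul, Complex.norm_I, one_mul, e]
  have h3 : ‖a • P₂‖ ≤ ε / 2 := by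
    rw [norm_smul]
    have h4 := mul_le_mul_of_nonneg_left h2n.le (norm_nonneg a)
    have h5 : ‖a‖ * (ε / 2 / (‖a‖ + 1)) ≤ ε / 2 := by
      rw [mul_div_assoc', div_le_iff₀ (by positivity)]
      nlinarith [norm_nonneg a]
    exact h4.trans h5
  linarith [norm_sub_le (a • P₂) (y - c • g - P₁)]

/-! ### Division by `v - u` for real `u` -/

lemma integrableOn_abs_sub_rpow {r : ℝ} (hr : -1 < r) (u δ : ℝ) :
    IntegrableOn (fun x => |x - u| ^ r) (Metric.ball u δ) := by
  -- The complex power is convenient because its norm is `|x| ^ r` on both sides of `0`.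
  have h1 : IntervalIntegrable (fun x : ℝ => (x : ℂ) ^ (r : ℂ)) volume (-δ) δ :=
    intervalIntegral.intervalIntegrable_cpow' (by simpa using hr)
  have h2 := (h1.comp_sub_right u).norm
  simp only [Complex.norm_cpow_real, Complex.norm_real, Real.norm_eq_abs] at h2
  rw [Real.ball_eq_Ioo]
  refine ((intervalIntegrable_iff.1 h2).mono_set ?_)
  intro x hx
  rw [mem_uIoc]
  left
  constructor <;> linarith [hx.1, hx.2]

/-- Near `u` the singularity `|x - u| ^ (α - 1)` is integrable because `α > 0`; outside the ball the
denominator is at least `δ ^ j` in norm. -/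
lemma integrable_div_pow {f : ℝ → ℂ} (hf : Integrable f) {u δ α C : ℝ} (hδ : 0 < δ) (hα : 0 < α)
    (j : ℕ) (h : ∀ᵐ x, x ∈ Metric.ball u δ → ‖f x / ((x : ℂ) - u) ^ j‖ ≤ C * |x - u| ^ (α - 1)) :
    Integrable fun x => f x / ((x : ℂ) - u) ^ j := by
  have hm : AEStronglyMeasurable (fun x : ℝ => f x / ((x : ℂ) - u) ^ j) volume :=
    hf.aestronglyMeasurable.div₀
      (Continuous.aestronglyMeasurable (by fun_prop))
  have hb : MeasurableSet (Metric.ball u δ) := Metric.isOpen_ball.measurableSet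
  rw [← integrableOn_univ, ← union_compl_self (Metric.ball u δ), integrableOn_union]
  constructor
  · refine Integrable.mono' ((integrableOn_abs_sub_rpow (r := α - 1) (by linarith) u δ).const_mul C)
      hm.restrict ?_
    rwa [ae_restrict_iff' hb]
  · refine Integrable.mono' ((hf.norm.div_const (δ ^ j)).integrableOn) hm.restrict ?_
    rw [ae_restrict_iff' hb.compl]
    refine Eventually.of_forall fun x hx => ?_
    have hx' : δ ≤ ‖(x : ℂ) - u‖ := by
      rw [← Complex.ofReal_sub, Complex.norm_real, ← dist_eq_norm]
      simpa using hx
    rw [norm_div, norm_pow]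
    exact div_le_div_of_nonneg_left (norm_nonneg _) (pow_pos hδ j) (pow_le_pow_left₀ hδ.le hx' j)

/-- Here `s * conjCauchy (s * y) = (1 - cauchy (s * y)) / y` is a smooth regularisation of `1 / y`;
bounds uniform in `s` on it and on its derivative provide the dominating functions for division by
`v - u`. -/
lemma abs_mul_conjCauchy_le {s y : ℝ} (hs : 0 < s) (hy : y ≠ 0) :
    |s * conjCauchy (s * y)| ≤ |y|⁻¹ := by
  have h0 := one_add_sq_pos (s * y)
  rw [conjCauchy, ← div_eq_mul_inv, abs_mul, abs_div, abs_of_pos h0, abs_mul, abs_of_pos hs,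
    ← mul_div_assoc, div_le_iff₀ h0, ← div_eq_inv_mul, le_div_iff₀ (abs_pos.2 hy)]
  have e : s * (s * |y|) * |y| = (s * y) ^ 2 := by rw [mul_pow, ← sq_abs y]; ring
  linarith

lemma sq_mul_abs_deriv_conjCauchy_le (s : ℝ) {y : ℝ} (hy : y ≠ 0) :
    s ^ 2 * |deriv conjCauchy (s * y)| ≤ (y ^ 2)⁻¹ := by
  have hy2 : 0 < y ^ 2 := by positivity
  refine (mul_le_mul_of_nonneg_left (abs_deriv_conjCauchy_le _) (sq_nonneg s)).trans ?_
  rw [cauchy, ← div_eq_mul_inv, div_le_iff₀ (one_add_sq_pos _), ← div_eq_inv_mul,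
    le_div_iff₀ hy2]
  nlinarith

lemma tendsto_cauchy_mul {y : ℝ} (hy : y ≠ 0) :
    Tendsto (fun n : ℕ => cauchy (((n : ℝ) + 1) * y)) atTop (𝓝 0) := by
  have h1 : Tendsto (fun n : ℕ => (n : ℝ) + 1) atTop atTop :=
    tendsto_atTop_add_const_right _ _ tendsto_natCast_atTop_atTop
  have h2 : Tendsto (fun n : ℕ => 1 + (((n : ℝ) + 1) * y) ^ 2) atTop atTop := by
    refine tendsto_atTop_add_const_left _ _ ?_
    simp only [mul_pow]
    exact ((tendsto_pow_atTop two_ne_zero).comp h1).atTop_mul_const (by positivity)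
  exact h2.inv_tendsto_atTop

lemma tendsto_mul_conjCauchy {y : ℝ} (hy : y ≠ 0) :
    Tendsto (fun n : ℕ => ((n : ℝ) + 1) * conjCauchy ((n + 1) * y)) atTop (𝓝 y⁻¹) := by
  have e : ∀ n : ℕ, ((n : ℝ) + 1) * conjCauchy ((n + 1) * y) =
      (1 - cauchy (((n : ℝ) + 1) * y)) * y⁻¹ := fun n => by
    have := (one_add_sq_pos (((n : ℝ) + 1) * y)).ne'
    rw [cauchy, conjCauchy]
    field_simp
    ring
  simp only [e]
  simpa using ((tendsto_cauchy_mul hy).const_sub 1).mul_const y⁻¹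

lemma tendsto_sq_mul_deriv_conjCauchy {y : ℝ} (hy : y ≠ 0) :
    Tendsto (fun n : ℕ => ((n : ℝ) + 1) ^ 2 * deriv conjCauchy ((n + 1) * y)) atTop
      (𝓝 (-(y ^ 2)⁻¹)) := by
  have e : ∀ n : ℕ, ((n : ℝ) + 1) ^ 2 * deriv conjCauchy ((n + 1) * y) =
      (1 - cauchy (((n : ℝ) + 1) * y)) * (2 * cauchy (((n : ℝ) + 1) * y) - 1) * (y ^ 2)⁻¹ :=
    fun n => by
      have := (one_add_sq_pos (((n : ℝ) + 1) * y)).ne'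
      rw [(hasDerivAt_conjCauchy _).deriv, cauchy]
      field_simp
      ring
  simp only [e]
  simpa using ((((tendsto_cauchy_mul hy).const_sub 1).mul
    (((tendsto_cauchy_mul hy).const_mul 2).sub_const 1)).mul_const (y ^ 2)⁻¹)

/-- The quotient by `v - u` of a function which vanishes sufficiently well at `u`. -/
lemma memW11_div_sub {f g : ℝ → ℂ} (h : HasWeakDeriv f g) (hf : Integrable f) (hg : Integrable g)
    {u : ℝ} (hf2 : Integrable fun x : ℝ => f x / ((x : ℂ) - u) ^ 2)
    (hf1 : Integrable fun x : ℝ => f x / ((x : ℂ) - u))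
    (hg1 : Integrable fun x : ℝ => g x / ((x : ℂ) - u)) :
    MemW11 fun x : ℝ => f x / ((x : ℂ) - u) := by
  have hs : ∀ n : ℕ, (0 : ℝ) < n + 1 := fun n => by positivity
  set ψ : ℕ → ℝ → ℝ := fun n x => ((n : ℝ) + 1) * conjCauchy ((n + 1) * (x - u)) with hψ_def
  have hψ : ∀ n, ContDiff ℝ ∞ (ψ n) := fun n => contDiff_const.mul
    (contDiff_conjCauchy.comp (contDiff_const.mul (contDiff_id.sub contDiff_const)))
  have hd : ∀ n x, deriv (ψ n) x = ((n : ℝ) + 1) ^ 2 * deriv conjCauchy ((n + 1) * (x - u)) := by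
    intro n x
    have h1 : HasDerivAt (fun x : ℝ => ((n : ℝ) + 1) * (x - u)) (n + 1) x := by
      simpa using ((hasDerivAt_id x).sub_const u).const_mul ((n : ℝ) + 1)
    refine (((((contDiff_conjCauchy.differentiable (by simp) _).hasDerivAt.comp x h1).const_mul
      ((n : ℝ) + 1))).deriv).trans ?_
    ring
  have hdc : ∀ n x, deriv (fun x => (ψ n x : ℂ)) x = ((deriv (ψ n) x : ℝ) : ℂ) := fun n x =>
    deriv_ofReal_comp (hψ n) x
  have hψ1 : ∀ n x, ‖(ψ n x : ℂ)‖ ≤ (n : ℝ) + 1 := fun n x => by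
    rw [Complex.norm_real, Real.norm_eq_abs, abs_mul, abs_of_pos (hs n)]
    exact mul_le_of_le_one_right (hs n).le (abs_conjCauchy_le_one _)
  have hψ2 : ∀ n x, ‖deriv (fun x => (ψ n x : ℂ)) x‖ ≤ ((n : ℝ) + 1) ^ 2 := fun n x => by
    rw [hdc, hd, Complex.norm_real, Real.norm_eq_abs, abs_mul, abs_of_pos (pow_pos (hs n) 2)]
    exact mul_le_of_le_one_right (sq_nonneg _)
      ((abs_deriv_conjCauchy_le _).trans (cauchy_le_one _))
  have hI := fun n => integrable_mul_and_deriv hf hg (contDiff_ofReal_comp (hψ n))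
    (hψ1 n) (hψ2 n)
  have hψb : ∀ n x, x ≠ u → ‖(ψ n x : ℂ)‖ ≤ ‖(x : ℂ) - u‖⁻¹ := fun n x hx => by
    rw [Complex.norm_real, ← Complex.ofReal_sub, Complex.norm_real]
    exact abs_mul_conjCauchy_le (hs n) (sub_ne_zero.2 hx)
  have hψb' : ∀ n x, x ≠ u → ‖deriv (fun x => (ψ n x : ℂ)) x‖ ≤ (‖(x : ℂ) - u‖ ^ 2)⁻¹ :=
    fun n x hx => by
      rw [hdc, hd, Complex.norm_real, ← Complex.ofReal_sub, Complex.norm_real, Real.norm_eq_abs,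
        Real.norm_eq_abs, abs_mul, sq_abs, abs_of_pos (pow_pos (hs n) 2)]
      exact sq_mul_abs_deriv_conjCauchy_le _ (sub_ne_zero.2 hx)
  refine ⟨hf1, fun x => g x / ((x : ℂ) - u) - f x / ((x : ℂ) - u) ^ 2, hg1.sub hf2, ?_⟩
  -- Off `u`, the `ψ n` tend to `1/(x - u)` and their derivatives to `-1/(x - u)²`, dominated by the
  -- absolute values of these limits; the product rule therefore passes to the limit.
  refine HasWeakDeriv.of_tendsto (fun n => h.mul_left hf hg (contDiff_ofReal_comp (hψ n)))
    (fun n => (hI n).1) (fun n => (hI n).2) hf1.norm (hg1.norm.add hf2.norm)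
    (fun n => ?_) (fun n => ?_) ?_ ?_
  · filter_upwards [Measure.ae_ne volume u] with x hx
    rw [norm_mul, norm_div, div_eq_inv_mul]
    exact mul_le_mul_of_nonneg_right (hψb n x hx) (norm_nonneg _)
  · filter_upwards [Measure.ae_ne volume u] with x hx
    refine (norm_add_le _ _).trans ?_
    simp only [Pi.add_apply]
    rw [norm_mul, norm_mul, norm_div, norm_div, norm_pow, div_eq_inv_mul, div_eq_inv_mul]
    exact add_le_add (mul_le_mul_of_nonneg_right (hψb n x hx) (norm_nonneg _))
      (mul_le_mul_of_nonneg_right (hψb' n x hx) (norm_nonneg _))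
  · filter_upwards [Measure.ae_ne volume u] with x hx
    have h1 := ((Complex.continuous_ofReal.tendsto _).comp
      (tendsto_mul_conjCauchy (sub_ne_zero.2 hx))).mul_const (f x)
    have e : f x / ((x : ℂ) - u) = (((x - u)⁻¹ : ℝ) : ℂ) * f x := by
      push_cast
      rw [div_eq_inv_mul]
    rw [e]
    exact h1
  · filter_upwards [Measure.ae_ne volume u] with x hx
    have h1 := ((Complex.continuous_ofReal.tendsto _).comp
      (tendsto_mul_conjCauchy (sub_ne_zero.2 hx))).mul_const (g x)
    have h2 := ((Complex.continuous_ofReal.tendsto _).comp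
      (tendsto_sq_mul_deriv_conjCauchy (sub_ne_zero.2 hx))).mul_const (f x)
    convert h1.add h2 using 2 with n
    · rw [hdc, hd]
      rfl
    · push_cast
      rw [div_eq_inv_mul, div_eq_inv_mul]
      ring

/-- If `p u ≠ 0`, then `(v - u)⁻¹`, which is not integrable near `u`, would be bounded there by a
multiple of the integrand. -/
lemma eq_zero_of_integrable_div_sub {p : ℝ → ℝ} (hp : Continuous p) {u : ℝ}
    (h : Integrable fun v : ℝ => (p v : ℂ) / ((v : ℂ) - u)) : p u = 0 := by
  by_contra hne
  refine not_intervalIntegrable_of_sub_inv_isBigO_punctured (c := u) (a := u) (b := u + 1)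
    ?_ (by simp) (by simp) (h.intervalIntegrable)
  have h1 : ∀ᶠ v in 𝓝 u, |p u| / 2 < |p v| :=
    (hp.abs.tendsto u).eventually_const_lt (half_lt_self (abs_pos.2 hne))
  refine Asymptotics.IsBigO.of_bound (2 / |p u|) ?_
  filter_upwards [h1.filter_mono nhdsWithin_le_nhds] with v hv
  rw [norm_div, Complex.norm_real, ← Complex.ofReal_sub, Complex.norm_real, norm_inv,
    Real.norm_eq_abs (p v), ← mul_div_assoc, inv_eq_one_div]
  refine div_le_div_of_nonneg_right ?_ (norm_nonneg _)
  have hpos := abs_pos.2 hne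
  rw [div_mul_eq_mul_div, le_div_iff₀ hpos]
  linarith

/-- With `D = f₀''(u)`, the cut-off linear part `D (x - u) χ` of `f₀'` has the smooth quotient `D
χ`. Near `u` the remainder `f` is `O(|x - u|^(1+α))` and its derivative `O(|x - u|^α)`, so `f/(x -
u)²` and `f'/(x - u)` have integrable singularities. -/
lemma memW11_deriv_div_sub {f₀ : ℝ → ℝ} (hf₀ : ContDiff ℝ 1 f₀)
    (hW : MemW11 fun v : ℝ => ((deriv f₀ v : ℝ) : ℂ)) {u : ℝ} (hH : HolderC2At f₀ u)
    (hi : Integrable fun v : ℝ => ((deriv f₀ v : ℝ) : ℂ) / ((v : ℂ) - u)) :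
    MemW11 fun v : ℝ => ((deriv f₀ v : ℝ) : ℂ) / ((v : ℂ) - u) := by
  obtain ⟨hC2, α, hα, C, hC⟩ := hH
  obtain ⟨hpi, G, hG, hpG⟩ := hW
  set p : ℝ → ℝ := deriv f₀
  have hpc : Continuous p := hf₀.continuous_deriv le_rfl
  -- Convergence of the dispersion integral excludes a constant term in the Taylor expansion of `p`
  -- at `u`.
  have hpu : p u = 0 := eq_zero_of_integrable_div_sub hpc hi
  have hpd : ∀ᶠ v in 𝓝 u, DifferentiableAt ℝ p v := by
    filter_upwards [hC2.eventually (by simp)] with v hv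
    exact (hv.derivWithin (m := 1) (by norm_num)).differentiableAt (by simp)
  obtain ⟨δ, hδ, hball⟩ := Metric.eventually_nhds_iff_ball.1 (hpd.and hC)
  set D : ℝ := deriv p u
  let χ : ContDiffBump u := ⟨δ, 2 * δ, hδ, by linarith⟩
  set q : ℝ → ℝ := fun x => D * (x - u) * χ x with hq_def
  have hq : ContDiff ℝ ∞ q := (contDiff_const.mul (contDiff_id.sub contDiff_const)).mul χ.contDiff
  have hqc : HasCompactSupport q := χ.hasCompactSupport.mul_left
  have hqC := contDiff_ofReal_comp hq
  have hqcC := hasCompactSupport_ofReal_comp hqc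
  have hdqC : Continuous (deriv fun x => (q x : ℂ)) := hqC.continuous_deriv (by norm_num)
  have iq : Integrable fun x => (q x : ℂ) := hqC.continuous.integrable_of_hasCompactSupport hqcC
  have iq' : Integrable (deriv fun x => (q x : ℂ)) :=
    hdqC.integrable_of_hasCompactSupport hqcC.deriv
  have hqw : HasWeakDeriv (fun x => (q x : ℂ)) (deriv fun x => (q x : ℂ)) :=
    HasWeakDeriv.of_hasDerivAt (fun x => (hqC.differentiable (by simp) x).hasDerivAt) iq iq'
  set f : ℝ → ℂ := (fun v => (p v : ℂ)) + (-1 : ℂ) • fun x => (q x : ℂ) with hf_def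
  set g : ℝ → ℂ := G + (-1 : ℂ) • (deriv fun x => (q x : ℂ)) with hg_def
  have hfg : HasWeakDeriv f g := hpG.add (hqw.const_smul (-1)) hpi hG (iq.smul _) (iq'.smul _)
  have hf : Integrable f := hpi.add (iq.smul _)
  have hg : Integrable g := hG.add (iq'.smul _)
  have hqb : ∀ x ∈ Metric.ball u δ, q x = D * (x - u) := fun x hx => by
    rw [hq_def]
    beta_reduce
    rw [χ.one_of_mem_closedBall (Metric.ball_subset_closedBall hx), mul_one]
  have hqb' : ∀ x ∈ Metric.ball u δ, deriv q x = D := fun x hx => by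
    have e : q =ᶠ[𝓝 x] fun x => D * (x - u) := by
      filter_upwards [Metric.isOpen_ball.mem_nhds hx] with y hy using hqb y hy
    rw [e.deriv_eq]
    simp
  have bound_f : ∀ x ∈ Metric.ball u δ, ‖f x‖ ≤ |C| * |x - u| ^ α * |x - u| := by
    intro x hx
    have hfx : f x = ((p x - D * x - (p u - D * u) : ℝ) : ℂ) := by
      simp only [hf_def, Pi.add_apply, Pi.smul_apply, smul_eq_mul]
      rw [hqb x hx, hpu]
      push_cast
      ring
    rw [hfx, Complex.norm_real]
    have hsub : uIcc u x ⊆ Metric.ball u δ := by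
      rw [← segment_eq_uIcc]
      exact (convex_ball u δ).segment_subset (Metric.mem_ball_self hδ) hx
    -- Mean value inequality for `p y - D y`, whose derivative is controlled by the Hölder bound
    -- between `u` and `x`.
    refine (convex_uIcc u x).norm_image_sub_le_of_norm_hasDerivWithin_le
      (f := fun y => p y - D * y) (f' := fun y => deriv p y - D) (fun y hy => ?_) (fun y hy => ?_)
      left_mem_uIcc right_mem_uIcc
    · have h1 := (hball y (hsub hy)).1.hasDerivAt.sub ((hasDerivAt_id y).const_mul D)
      rw [mul_one] at h1
      exact h1.hasDerivWithinAt
    · refine ((hball y (hsub hy)).2.trans (mul_le_mul_of_nonneg_right (le_abs_self C)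
        (by positivity))).trans ?_
      refine mul_le_mul_of_nonneg_left (Real.rpow_le_rpow (abs_nonneg _) ?_ hα.le) (abs_nonneg C)
      exact abs_sub_left_of_mem_uIcc hy
  -- `G` is only some integrable weak derivative. Its primitive is the continuous function `p`, so
  -- Lebesgue differentiation identifies it a.e. with the classical derivative on the ball.
  have hGp : ∀ᵐ x, x ∈ Metric.ball u δ → G x = ((deriv p x : ℝ) : ℂ) := by
    have e : primitive G = fun v => (p v : ℂ) :=
      ((continuous_primitive hG).ae_eq_iff_eq volume (Complex.continuous_ofReal.comp hpc)).1
        (hpG.ae_eq_primitive hpi hG).symm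
    filter_upwards [ae_hasDerivAt_primitive hG] with x h1 hx
    rw [e] at h1
    exact h1.unique (hball x hx).1.hasDerivAt.ofReal_comp
  have bound_g : ∀ᵐ x, x ∈ Metric.ball u δ → ‖g x‖ ≤ |C| * |x - u| ^ α := by
    filter_upwards [hGp] with x h1 hx
    have hgx : g x = ((deriv p x - D : ℝ) : ℂ) := by
      simp only [hg_def, Pi.add_apply, Pi.smul_apply, smul_eq_mul]
      rw [h1 hx, deriv_ofReal_comp hq, hqb' x hx]
      push_cast
      ring
    rw [hgx, Complex.norm_real]
    exact (hball x hx).2.trans (mul_le_mul_of_nonneg_right (le_abs_self C) (by positivity))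
  have hnorm : ∀ x : ℝ, ‖(x : ℂ) - u‖ = |x - u| := fun x => by
    rw [← Complex.ofReal_sub, Complex.norm_real, Real.norm_eq_abs]
  have i2 : Integrable fun x : ℝ => f x / ((x : ℂ) - u) ^ 2 := by
    refine integrable_div_pow hf hδ hα 2 (C := |C|) ?_
    filter_upwards [Measure.ae_ne volume u] with x hx hxb
    have h0 : 0 < |x - u| := abs_pos.2 (sub_ne_zero.2 hx)
    rw [norm_div, norm_pow, hnorm, Real.rpow_sub_one h0.ne', div_le_iff₀ (pow_pos h0 2)]
    refine (bound_f x hxb).trans_eq ?_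
    field_simp
  have i1 : Integrable fun x : ℝ => g x / ((x : ℂ) - u) := by
    have := integrable_div_pow hg hδ hα 1 (u := u) (C := |C|) ?_
    · simpa only [pow_one] using this
    · filter_upwards [Measure.ae_ne volume u, bound_g] with x hx h1 hxb
      have h0 : 0 < |x - u| := abs_pos.2 (sub_ne_zero.2 hx)
      rw [norm_div, norm_pow, hnorm, Real.rpow_sub_one h0.ne', div_le_iff₀ (pow_pos h0 1)]
      refine (h1 hxb).trans_eq ?_
      field_simp
  have hDχ : ContDiff ℝ ∞ fun x => D * χ x := contDiff_const.mul χ.contDiff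
  have hDχc : HasCompactSupport fun x => D * χ x := χ.hasCompactSupport.mul_left
  have hχC := contDiff_ofReal_comp hDχ
  have hχcC := hasCompactSupport_ofReal_comp hDχc
  have hχi : Integrable fun x => ((D * χ x : ℝ) : ℂ) :=
    hχC.continuous.integrable_of_hasCompactSupport hχcC
  have hχi' : Integrable (deriv fun x => ((D * χ x : ℝ) : ℂ)) :=
    (hχC.continuous_deriv (by norm_num)).integrable_of_hasCompactSupport hχcC.deriv
  have hχ : MemW11 fun x => ((D * χ x : ℝ) : ℂ) := ⟨hχi, _, hχi', HasWeakDeriv.of_hasDerivAt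
    (fun x => (hχC.differentiable (by simp) x).hasDerivAt) hχi hχi'⟩
  have hsplit : ∀ x : ℝ, x ≠ u →
      f x / ((x : ℂ) - u) + ((D * χ x : ℝ) : ℂ) = (p x : ℂ) / ((x : ℂ) - u) := fun x hx => by
    have h0 : (x : ℂ) - u ≠ 0 := sub_ne_zero.2 (Complex.ofReal_injective.ne hx)
    simp only [hf_def, hq_def, Pi.add_apply, Pi.smul_apply, smul_eq_mul]
    push_cast
    field_simp
    ring
  have i0 : Integrable fun x : ℝ => f x / ((x : ℂ) - u) := by
    refine (hi.sub hχi).congr ?_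
    filter_upwards [Measure.ae_ne volume u] with x hx
    rw [Pi.sub_apply, ← hsplit x hx, add_sub_cancel_right]
  refine ((memW11_div_sub hfg hf hg i2 i0 i1).add hχ).congr ?_
  filter_upwards [Measure.ae_ne volume u] with x hx using hsplit x hx

/-! ### The parts of the spectrum -/

section Parts

variable {E : Type*} [NormedAddCommGroup E] [NormedSpace ℂ E]

/-- A bounded, everywhere defined inverse forces injectivity, full range and a norm bound, and each
part of the spectrum denies one of these. -/
lemma parts_subset_spectrum (T : E →ₗ.[ℂ] E) :
    pointSpectrum T ∪ continuousSpectrum T ∪ residualSpectrum T ⊆ spectrum T := by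
  rintro z hz ⟨R, h1, h2⟩
  have hinj : Function.Injective (shifted T z) := fun x y hxy =>
    Subtype.ext ((h1 x).symm.trans ((congrArg R hxy).trans (h1 y)))
  have hsurj : Function.Surjective (shifted T z) := fun y => (h2 y).imp fun _ h => h.2
  rcases hz with (hz | hz) | hz
  · exact hz hinj
  · exact hz.2.2 ⟨‖R‖, fun x => by simpa only [h1] using R.le_opNorm (shifted T z x)⟩
  · exact hz.2 hsurj.denseRange

end Parts

lemma ae_ofReal_sub_ne_zero (u : ℂ) : ∀ᵐ v : ℝ, (v : ℂ) - u ≠ 0 := by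
  filter_upwards [Measure.ae_ne volume u.re] with v hv h
  apply hv
  have := congrArg Complex.re h
  simpa [sub_eq_zero] using this

/-! ### Eigenvalues and the dispersion relation -/

section Dispersion

variable {k : ℝ} {f₀ : ℝ → ℝ} {u : ℂ}

/-- An eigenfunction satisfies `f = κ J f₀'/(v - u)` a.e. with `J = ∫ f`. Here `J ≠ 0`, otherwise `f
= 0`; so the integrand inherits integrability from `f`, and integrating and dividing by `J` gives
the relation. -/
lemma dispersionRelation_of_mem_pointSpectrum
    (hW : MemW11 fun v : ℝ => ((deriv f₀ v : ℝ) : ℂ))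
    (hk : 0 < k)
    (h : Complex.I * u ∈ pointSpectrum (vlasovOperator k hW.toW11)) :
    DispersionRelation k f₀ u := by
  have hk2 : ((k : ℂ) ^ 2)⁻¹ ≠ 0 := inv_ne_zero (pow_ne_zero 2 (Complex.ofReal_ne_zero.2 hk.ne'))
  set κ : ℂ := ((k : ℂ) ^ 2)⁻¹
  have h' : ∃ x, shifted (vlasovOperator k hW.toW11) (Complex.I * u) x = 0 ∧ x ≠ 0 := by
    by_contra hne
    push Not at hne
    exact h ((injective_iff_map_eq_zero _).2 hne)
  obtain ⟨x, hx, hx0⟩ := h'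
  have e : ∀ᵐ v : ℝ, x.1.fn v =
      integralCLM x.1 * κ * dispersionIntegrand f₀ u v := by
    have hz := shifted_fn (k := k) (g := hW.toW11) (u := u) x
    rw [hx] at hz
    filter_upwards [hz, W11.fn_zero, hW.fn_toW11, ae_ofReal_sub_ne_zero u] with v h1 h2 h3 h4
    rw [h2, h3] at h1
    have h5 : ((v : ℂ) - u) * x.1.fn v = integralCLM x.1 * κ * ((deriv f₀ v : ℝ) : ℂ) :=
      sub_eq_zero.1 ((mul_eq_zero.1 h1.symm).resolve_left Complex.I_ne_zero)
    rw [dispersionIntegrand, mul_div_assoc', eq_div_iff h4, ← h5, mul_comm]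
  have hJ : integralCLM x.1 ≠ 0 := by
    intro h0
    apply hx0
    apply Subtype.ext
    refine W11.ext_fn ?_
    filter_upwards [e, W11.fn_zero] with v h1 h2
    rw [h1, h0, zero_mul, zero_mul]
    exact h2.symm
  have hc : integralCLM x.1 * κ ≠ 0 := mul_ne_zero hJ hk2
  have e' : dispersionIntegrand f₀ u =ᵐ[volume]
      fun v => (integralCLM x.1 * κ)⁻¹ * x.1.fn v := by
    filter_upwards [e] with v hv
    rw [hv, inv_mul_cancel_left₀ hc]
  refine ⟨(x.1.integrable_fn.const_mul _).congr e'.symm, ?_⟩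
  rw [integral_congr_ae e', integral_const_mul, ← integralCLM_apply]
  change 1 - κ * _ = 0
  field_simp
  ring

/-- The eigenfunction is `f₀'/(v - u)`: the relation says that `k⁻²` times its integral is `1`, so
the two terms of the operator cancel and the function is not zero. -/
lemma mem_pointSpectrum_of_dispersionRelation
    (hW : MemW11 fun v : ℝ => ((deriv f₀ v : ℝ) : ℂ))
    (h : DispersionRelation k f₀ u)
    (hm : MemW11 fun v : ℝ => ((deriv f₀ v : ℝ) : ℂ) / ((v : ℂ) - u)) :
    Complex.I * u ∈ pointSpectrum (vlasovOperator k hW.toW11) := by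
  have hP : hW.toW11.fn =ᵐ[volume] fun v : ℝ => ((v : ℂ) - u) * hm.toW11.fn v := by
    filter_upwards [hW.fn_toW11, hm.fn_toW11, ae_ofReal_sub_ne_zero u] with v h1 h2 h3
    rw [h1, h2, mul_div_cancel₀ _ h3]
  obtain ⟨x, hx, hs⟩ := exists_domain_shifted_eq (k := k) (g := hW.toW11) hP
  have hJ : integralCLM hm.toW11 = ∫ v, dispersionIntegrand f₀ u v := by
    rw [integralCLM_apply, integral_congr_ae hm.fn_toW11]
    rfl
  have h1 : integralCLM hm.toW11 * ((k : ℂ) ^ 2)⁻¹ = 1 := by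
    rw [hJ, mul_comm]
    exact (sub_eq_zero.1 h.2).symm
  rw [h1, one_smul, sub_self, smul_zero] at hs
  intro hinj
  have hx0 : x = 0 := hinj (hs.trans (map_zero _).symm)
  have : hm.toW11 = 0 := by rw [← hx, hx0]; rfl
  rw [this, map_zero, zero_mul] at h1
  exact zero_ne_one h1

lemma memW11_deriv_div_sub_of_im_ne_zero
    (hW : MemW11 fun v : ℝ => ((deriv f₀ v : ℝ) : ℂ))
    (hu : u.im ≠ 0) :
    MemW11 fun v : ℝ => ((deriv f₀ v : ℝ) : ℂ) / ((v : ℂ) - u) := by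
  obtain ⟨M, hM⟩ := exists_inv_sub_clm hu
  refine (M hW.toW11).memW11.congr ?_
  filter_upwards [hM hW.toW11, hW.fn_toW11] with v h1 h2
  rw [h1, h2, div_eq_inv_mul]

/-- For nonreal `u` the only obstruction to the resolvent formula is the dispersion relation, which
would produce an eigenvalue. -/
lemma notMem_spectrum_of_notMem_pointSpectrum
    (hW : MemW11 fun v : ℝ => ((deriv f₀ v : ℝ) : ℂ))
    (hu : u.im ≠ 0)
    (h : Complex.I * u ∉ pointSpectrum (vlasovOperator k hW.toW11)) :
    Complex.I * u ∉ spectrum (vlasovOperator k hW.toW11) := by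
  have hm := memW11_deriv_div_sub_of_im_ne_zero hW hu
  refine notMem_spectrum hu fun hd => h (mem_pointSpectrum_of_dispersionRelation hW ⟨hm.1, ?_⟩ hm)
  rw [← hd]
  congr 2
  refine integral_congr_ae ?_
  filter_upwards [hW.fn_toW11] with v hv
  rw [hv, dispersionIntegrand, div_eq_inv_mul]

end Dispersion

end Vlasov

end

/-! ### Classification of the spectrum -/

theorem mainTheorem6 (k : ℝ) (hk : 0 < k) (f₀ : ℝ → ℝ) (hf₀ : ContDiff ℝ 1 f₀)
    (hW : Vlasov.MemW11 fun v : ℝ => ((deriv f₀ v : ℝ) : ℂ)) :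
    let T := Vlasov.vlasovOperator k hW.toW11
    -- the spectrum is the union of its three parts
    Vlasov.spectrum T =
      Vlasov.pointSpectrum T ∪ Vlasov.continuousSpectrum T ∪ Vlasov.residualSpectrum T ∧
    -- every point of the point spectrum solves the dispersion relation
    (∀ z ∈ Vlasov.pointSpectrum T, ∃ u : ℂ, z = Complex.I * u ∧
      Vlasov.DispersionRelation k f₀ u) ∧
    -- every solution is in the point spectrum (for real `u`: if `f₀` is regular enough at `u`)
    (∀ u : ℂ, (u.im = 0 → Vlasov.HolderC2At f₀ u.re) → Vlasov.DispersionRelation k f₀ u →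
      Complex.I * u ∈ Vlasov.pointSpectrum T) ∧
    Vlasov.continuousSpectrum T = {z : ℂ | ∃ u : ℝ, z = Complex.I * u ∧
      z ∉ Vlasov.pointSpectrum T ∧ deriv f₀ u ≠ 0} ∧
    Vlasov.residualSpectrum T = {z : ℂ | ∃ u : ℝ, z = Complex.I * u ∧
      z ∉ Vlasov.pointSpectrum T ∧ deriv f₀ u = 0} := by
  intro T
  -- Since `f₀'` is continuous, it is the continuous representative of its class, and conditions at
  -- the point `u` can be stated through its value.
  have hrep : ∀ u : ℝ, hW.toW11.rep u = ((deriv f₀ u : ℝ) : ℂ) := fun u => by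
    rw [Vlasov.W11.rep_eq hW.fn_toW11
      (Complex.continuous_ofReal.comp (hf₀.continuous_deriv le_rfl))]
  have hI : ∀ z : ℂ, ∃ u : ℂ, z = Complex.I * u := fun z =>
    ⟨-Complex.I * z, by rw [← mul_assoc]; simp⟩
  have hcont : ∀ u : ℝ, Complex.I * u ∉ Vlasov.pointSpectrum T → deriv f₀ u ≠ 0 →
      Complex.I * u ∈ Vlasov.continuousSpectrum T := fun u h1 h2 =>
    ⟨not_not.1 h1, Vlasov.dense_range_shifted hk
      (by rw [hrep]; exact Complex.ofReal_ne_zero.2 h2), Vlasov.not_exists_bound_shifted k _ u⟩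
  have hnd : ∀ u : ℝ, deriv f₀ u = 0 → ¬ Dense (range (Vlasov.shifted T (Complex.I * u))) :=
    fun u h => Vlasov.not_dense_range_shifted (by rw [hrep, h, Complex.ofReal_zero])
  have hres : ∀ u : ℝ, Complex.I * u ∉ Vlasov.pointSpectrum T → deriv f₀ u = 0 →
      Complex.I * u ∈ Vlasov.residualSpectrum T := fun u h1 h2 => ⟨not_not.1 h1, hnd u h2⟩
  have hreal : ∀ z ∈ Vlasov.spectrum T, z ∉ Vlasov.pointSpectrum T →
      ∃ u : ℝ, z = Complex.I * u := by
    intro z hz hp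
    obtain ⟨u, rfl⟩ := hI z
    by_cases hu : u.im = 0
    · exact ⟨u.re, congrArg _ (Complex.ext (by simp) (by simpa using hu))⟩
    · exact absurd hz (Vlasov.notMem_spectrum_of_notMem_pointSpectrum hW hu hp)
  have hsub := Vlasov.parts_subset_spectrum T
  refine ⟨subset_antisymm (fun z hz => ?_) hsub, fun z hz => ?_, fun u hu hd => ?_,
    subset_antisymm (fun z hz => ?_) ?_, subset_antisymm (fun z hz => ?_) ?_⟩
  · by_cases hp : z ∈ Vlasov.pointSpectrum T
    · exact Or.inl (Or.inl hp)
    · obtain ⟨u, rfl⟩ := hreal z hz hp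
      by_cases h0 : deriv f₀ u = 0
      · exact Or.inr (hres u hp h0)
      · exact Or.inl (Or.inr (hcont u hp h0))
  · obtain ⟨u, rfl⟩ := hI z
    exact ⟨u, rfl, Vlasov.dispersionRelation_of_mem_pointSpectrum hW hk hz⟩
  · refine Vlasov.mem_pointSpectrum_of_dispersionRelation hW hd ?_
    by_cases h0 : u.im = 0
    · have e : u = (u.re : ℂ) := Complex.ext (by simp) (by simpa using h0)
      have hi := hd.1
      have hH := hu h0
      rw [e] at hi ⊢
      exact Vlasov.memW11_deriv_div_sub hf₀ hW hH hi
    · exact Vlasov.memW11_deriv_div_sub_of_im_ne_zero hW h0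
  · have hp : z ∉ Vlasov.pointSpectrum T := not_not.2 hz.1
    obtain ⟨u, rfl⟩ := hreal z (hsub (Or.inl (Or.inr hz))) hp
    exact ⟨u, rfl, hp, fun h0 => hnd u h0 hz.2.1⟩
  · rintro z ⟨u, rfl, hp, h0⟩
    exact hcont u hp h0
  · have hp : z ∉ Vlasov.pointSpectrum T := not_not.2 hz.1
    obtain ⟨u, rfl⟩ := hreal z (hsub (Or.inr hz)) hp
    -- Were `f₀'(u)` nonzero, the point would lie in the continuous spectrum and the range would be
    -- dense.
    exact ⟨u, rfl, hp, by_contra fun h0 => hz.2 (hcont u hp h0).2.1⟩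
  · rintro z ⟨u, rfl, hp, h0⟩
    exact hres u hp h0
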